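/- Let $\Omega$ be a (finite-dimensional, smooth, boundaryless) Riemannian manifold with Riemannian distance, $B_r(z)$ its open metric balls, and $T:\Omega\to\Omega$ a $C^{1+\zeta}$ map for some $\zeta\in(0,1]$ (i.e. $T$ is $C^1$ and in charts its derivative is locally $\zeta$-Hölder). Let $\mu$ be a $T$-invariant Borel probability measure and $\mathcal A=\{A_j\}_{j\in\mathbb N}$ a countable measurable partition of $\Omega$; write $\mathcal A^n=\bigvee_{i=0}^{n-1}T^{-i}\mathcal A$, whose elements are the $n$-cylinders. Suppose that $\mu$ is right $\phi$-mixing with respect to $\mathcal A$: there is a decreasing $\phi$ with $\phi(k)\to0$ such that $$|\mu(S\cap T^{-n-k}B)-\mu(S)\mu(B)|\le\phi(k)\,\mu(B)$$ for all $n,k$, all $S\in\sigma(\mathcal A^n)$ and all $B\in\sigma(\bigcup_j\mathcal A^j)$; and that $\phi(k)=O(k^{-m})$ for some $m>0$. Suppose also that there are constants $c_1,\kappa'$, $v>1$ and $d>0$ with $\kappa' d/v>1$ such that (i) every $n$-cylinder has diameter at most $c_1n^{-\kappa'}$, for all $n\ge1$; (ii) $\lim_{r\to0}\mu(B_{r+r^v}(z))/\mu(B_r(z))=1$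 for all $z\in\Omega$; (iii) $\mu(B_r(z))=O(r^d)$ as $r\to0$, for all $z\in\Omega$. For each $r>0$ choose an integer $n(r)\ge1$ with $n(r)^{-\kappa'}\le r^v$, and let $U_r^-$ (resp. $U_r^+$) be the union of the $n(r)$-cylinders contained in $B_r(z)$ (resp. meeting $B_r(z)$). If $z$ is periodic with prime period $p$, assume that each of the families $U_r=U_r^-$ and $U_r=U_r^+$ satisfies the following condition: there are $a_r\in(0,1)$ with $a_r\,n(r)\to\infty$ and $e_r\to0$ as $r\to0$ such that $$\Bigl|\mu\Bigl(\bigcap_{j=0}^{l}T^{-i_j}U_r\Bigr)-\mu\bigl(U_{r,i_l/p}\bigr)\Bigr|\le e_r\,\mu\bigl(U_{r,i_l/p}\bigr),\qquad U_{r,u}:=\bigcap_{j=0}^{u}T^{-pj}U_r,$$ for all $r>0$, all $l\ge0$ and all multiples $0=i_0<i_1<\dots<i_l\le a_r\,n(r)$ of $p$; and assume that the limit $\theta=\theta(z)=\lim_{r\to0}\mu(B_r(z)\cap T^{-p}B_r(z))/\mu(B_r(z))$ exists and $\theta<\tfrac12$. Let $\tau_U(x)=\inf\{j\ge1:T^jx\in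 U\}$ be the hitting time, and set $L=1$ if $z$ is not periodic and $L=1-\theta$ if $z$ is periodic. Then, for every $z\in\Omega$ as above: (a) for every $\alpha\in(0,\infty)$ such that $m>\frac{1-\epsilon}{\beta\epsilon}$ for some $\epsilon\in(0,\min(1,\alpha))$ and some $\beta\in(0,1)$, and for every $s>0$, $$\lim_{r\to0}\frac{-1}{s\,\mu(B_r(z))^{1-\alpha}}\log\mu\bigl(\tau_{B_r(z)}>s\,\mu(B_r(z))^{-\alpha}\bigr)=L;$$ (b) for $\alpha=0$, the limits $\ell(s)=\lim_{r\to0}\frac{-1}{s\,\mu(B_r(z))}\log\mu(\tau_{B_r(z)}>s)$ exist for all $s>0$, and $\lim_{s\to\infty}\ell(s)=L$. -/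

import Mathlib

open Set Filter Topology MeasureTheory
open scoped ENNReal Manifold ContDiff Bundle

noncomputable section

namespace HittingStats

section Manifold

/-- `T` is of class `C^{1+ζ}` (with `0 < ζ ≤ 1`): it is `C¹`, and, read in charts, its derivative is
locally `ζ`-Hölder continuous. -/
def IsC1Holder (k : ℕ) {Ω : Type*} [TopologicalSpace Ω]
    [ChartedSpace (EuclideanSpace ℝ (Fin k)) Ω] (ζ : ℝ) (T : Ω → Ω) : Prop :=
  ContMDiff (𝓡 k) (𝓡 k) 1 T ∧
    ∀ x : Ω, ∃ C : ℝ, ∃ V ∈ 𝓝 (extChartAt (𝓡 k) x x), ∀ u ∈ V, ∀ w ∈ V,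
      ‖fderiv ℝ (writtenInExtChartAt (𝓡 k) (𝓡 k) x T) u
          - fderiv ℝ (writtenInExtChartAt (𝓡 k) (𝓡 k) x T) w‖ ≤ C * ‖u - w‖ ^ ζ

end Manifold

section Partition

/-- A countable measurable partition `{A₀, A₁, …}` of `Ω`. Empty pieces are allowed, so that finite
partitions are included. -/
structure IsMeasurablePartition {Ω : Type*} [MeasurableSpace Ω] (A : ℕ → Set Ω) : Prop where
  measurableSet : ∀ i, MeasurableSet (A i)
  disjoint : Pairwise fun i j => Disjoint (A i) (A j)
  iUnion_eq : ⋃ i, A i = univ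

/-- The `n`-cylinders, that is, the elements of the join `𝒜ⁿ = ⋁_{i<n} T⁻ⁱ𝒜`. -/
def cylinders {Ω : Type*} (T : Ω → Ω) (A : ℕ → Set Ω) (n : ℕ) : Set (Set Ω) :=
  range fun w : Fin n → ℕ => ⋂ i : Fin n, T^[(i : ℕ)] ⁻¹' A (w i)

/-- `σ(𝒜ⁿ)`. -/
abbrev cylinderAlgebra {Ω : Type*} (T : Ω → Ω) (A : ℕ → Set Ω) (n : ℕ) : MeasurableSpace Ω :=
  MeasurableSpace.generateFrom (cylinders T A n)

/-- `σ(⋃ⱼ 𝒜ʲ)`. -/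
abbrev cylinderAlgebraTop {Ω : Type*} (T : Ω → Ω) (A : ℕ → Set Ω) : MeasurableSpace Ω :=
  MeasurableSpace.generateFrom (⋃ j : ℕ, cylinders T A j)

/-- `μ` is right `φ`-mixing with respect to the partition `A`. -/
structure IsRightPhiMixing {Ω : Type*} [MeasurableSpace Ω] (μ : Measure Ω) (T : Ω → Ω)
    (A : ℕ → Set Ω) (φ : ℕ → ℝ) : Prop where
  antitone : Antitone φ
  tendsto_zero : Tendsto φ atTop (𝓝 0)
  mixing : ∀ (n j : ℕ) (S B : Set Ω), MeasurableSet[cylinderAlgebra T A n] S →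
    MeasurableSet[cylinderAlgebraTop T A] B →
      |μ.real (S ∩ T^[n + j] ⁻¹' B) - μ.real S * μ.real B| ≤ φ j * μ.real B

end Partition

section Balls

/-- The open ball `B_r(z)` of the (extended) distance. -/
def rball {Ω : Type*} [EMetricSpace Ω] (z : Ω) (r : ℝ) : Set Ω :=
  Metric.eball z (ENNReal.ofReal r)

/-- The inner approximation `U_n⁻` of `B_r(z)`: the union of the `n`-cylinders inside it. -/
def innerApprox {Ω : Type*} [EMetricSpace Ω] (T : Ω → Ω) (A : ℕ → Set Ω) (z : Ω) (n : ℕ) (r : ℝ) :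
    Set Ω :=
  ⋃₀ {C | C ∈ cylinders T A n ∧ C ⊆ rball z r}

/-- The outer approximation `U_n⁺` of `B_r(z)`: the union of the `n`-cylinders that meet it. -/
def outerApprox {Ω : Type*} [EMetricSpace Ω] (T : Ω → Ω) (A : ℕ → Set Ω) (z : Ω) (n : ℕ) (r : ℝ) :
    Set Ω :=
  ⋃₀ {C | C ∈ cylinders T A n ∧ (C ∩ rball z r).Nonempty}

end Balls

section Recurrence

/-- `U_{·,u} = ⋂_{j=0}^u T^{-pj} U`. -/
def iterInter {Ω : Type*} (T : Ω → Ω) (p : ℕ) (U : Set Ω) (u : ℕ) : Set Ω :=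
  ⋂ j ∈ Finset.range (u + 1), T^[p * j] ⁻¹' U

/-- The condition on the returns to a family `U r` (`r → 0⁺`), with `U r ∈ σ(𝒜^{N r})`, around a
point of prime period `p`: there are `a r ∈ (0,1)` with `a r * N r → ∞` and `e r → 0` such that
`μ(⋂_{j=0}^l T^{-i_j} U r) = μ(U_{r, i_l / p}) (1 + O*(e r))`, where `|O*(e)| ≤ e`, for all multiples
`0 = i_0 < ⋯ < i_l ≤ a r * N r` of `p`. -/
def NestedReturns {Ω : Type*} [MeasurableSpace Ω] (μ : Measure Ω) (T : Ω → Ω) (p : ℕ)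
    (N : ℝ → ℕ) (U : ℝ → Set Ω) : Prop :=
  ∃ a e : ℝ → ℝ, (∀ r, 0 < r → 0 < a r ∧ a r < 1) ∧
    Tendsto (fun r => a r * (N r : ℝ)) (𝓝[>] 0) atTop ∧
    Tendsto e (𝓝[>] 0) (𝓝 0) ∧
    ∀ r, 0 < r → ∀ (l : ℕ) (i : Fin (l + 1) → ℕ), i 0 = 0 → StrictMono i → (∀ j, p ∣ i j) →
      (i (Fin.last l) : ℝ) ≤ a r * (N r : ℝ) →
        |μ.real (⋂ j, T^[i j] ⁻¹' U r) - μ.real (iterInter T p (U r) (i (Fin.last l) / p))|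
          ≤ e r * μ.real (iterInter T p (U r) (i (Fin.last l) / p))

/-- The hitting time `τ_U(x) = inf {j ≥ 1 : T^j x ∈ U}`, equal to `∞` if the orbit never hits. -/
def hittingTime {Ω : Type*} (T : Ω → Ω) (U : Set Ω) (x : Ω) : ℕ∞ :=
  ⨅ (j : ℕ) (_ : 1 ≤ j ∧ T^[j] x ∈ U), (j : ℕ∞)

/-- `μ(τ_U > t)`. -/
def survival {Ω : Type*} [MeasurableSpace Ω] (μ : Measure Ω) (T : Ω → Ω) (U : Set Ω) (t : ℝ) : ℝ :=
  μ.real {x | ENNReal.ofReal t < (hittingTime T U x : ℝ≥0∞)}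

/-- `-1 / (s μ(U)^{1-α}) * log μ(τ_U > s μ(U)^{-α})`. -/
def recurrenceRate {Ω : Type*} [MeasurableSpace Ω] (μ : Measure Ω) (T : Ω → Ω) (α s : ℝ)
    (U : Set Ω) : ℝ :=
  -1 / (s * μ.real U ^ (1 - α)) * Real.log (survival μ T U (s * μ.real U ^ (-α)))

/-- `L_{α,s}(z) = L` along metric balls, for `α > 0` (the limit `r → 0` with `s` fixed). -/
def HasRecurrenceLimit {Ω : Type*} [EMetricSpace Ω] [MeasurableSpace Ω] (μ : Measure Ω)
    (T : Ω → Ω) (z : Ω) (α s L : ℝ) : Prop :=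
  Tendsto (fun r => recurrenceRate μ T α s (rball z r)) (𝓝[>] 0) (𝓝 L)

/-- `L_0(z) = L` along metric balls: for `α = 0` the limit is the iterated one,
`lim_{s → ∞} lim_{r → 0} -1 / (s μ(B_r)) * log μ(τ_{B_r} > s)`; all inner limits exist. -/
def HasRecurrenceLimitZero {Ω : Type*} [EMetricSpace Ω] [MeasurableSpace Ω] (μ : Measure Ω)
    (T : Ω → Ω) (z : Ω) (L : ℝ) : Prop :=
  ∃ ℓ : ℝ → ℝ, (∀ s, 0 < s → HasRecurrenceLimit μ T z 0 s (ℓ s)) ∧ Tendsto ℓ atTop (𝓝 L)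

end Recurrence

end HittingStats

end

/-!
By invariance `μ(τ_U > t) - μ(τ_U > t + 1) = μ(U ∩ {τ_U > t})`, so `1 - μ(τ_U > t)` is the sum over
`i < t` of the measures of `U ∩ {τ_U > i}`. For small balls the proportion of points of `U` that do
not return up to time `i` is close to the extremal index `L` as soon as `i` is large: it is `1`
away from periodic points, and `1 - θ` at a periodic point, where only the return after one
period counts; longer first returns are rare, since right `φ`-mixing and the bound on the diameters
of the cylinders make the returns cluster on bounded time scales. Hence
`1 - μ(τ_U > t) ∼ L t μ(U)` if `t` is large and `t μ(U)` is small.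

Mixing then almost factorizes `μ(τ_U > t)` into blocks of length `η / μ(U)` separated by short gaps.
The error per block is `o(η)`, so that `-log μ(τ_U > t) ∼ L t μ(U)` uniformly in all large `t`,
whatever the size of `t μ(U)`; no rate of mixing enters. All limits are read off from this.
Balls are not unions of cylinders, but they are sandwiched between inner and outer approximations
by cylinders, whose difference lies in an annulus of negligible measure.
-/

noncomputable section

namespace HittingStats

section Cylinders

variable {Ω : Type*} {T : Ω → Ω} {A : ℕ → Set Ω}

lemma measurableSet_preimage_piece (hA : ⋃ i, A i = univ) {n i : ℕ} (hi : i < n) (j : ℕ) :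
    MeasurableSet[cylinderAlgebra T A n] (T^[i] ⁻¹' A j) := by
  choose f hf using iUnion_eq_univ_iff.1 hA
  have h_union : T^[i] ⁻¹' A j = ⋃ w : {w : Fin n → ℕ // w ⟨i, hi⟩ = j},
      ⋂ l : Fin n, T^[(l : ℕ)] ⁻¹' A (w.1 l) := by
    ext x
    simp only [mem_preimage, mem_iUnion, mem_iInter]
    refine ⟨fun hx => ⟨⟨Function.update (fun l : Fin n => f (T^[(l : ℕ)] x)) ⟨i, hi⟩ j,
      by simp⟩, fun l => ?_⟩, fun ⟨⟨_, hw⟩, hx⟩ => hw ▸ hx ⟨i, hi⟩⟩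
    obtain rfl | hl := eq_or_ne l ⟨i, hi⟩
    · simpa using hx
    · simpa [hl] using hf (T^[(l : ℕ)] x)
  let := cylinderAlgebra T A n
  exact h_union ▸ MeasurableSet.iUnion fun w =>
    MeasurableSpace.measurableSet_generateFrom ⟨w.1, rfl⟩

lemma cylinderAlgebra_le {M : MeasurableSpace Ω} {n : ℕ}
    (h : ∀ i < n, ∀ j, MeasurableSet[M] (T^[i] ⁻¹' A j)) : cylinderAlgebra T A n ≤ M := by
  refine MeasurableSpace.generateFrom_le ?_
  rintro _ ⟨w, rfl⟩
  exact MeasurableSet.iInter fun i => h i i.2 _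

lemma cylinderAlgebra_mono (hA : ⋃ i, A i = univ) : Monotone (cylinderAlgebra T A) :=
  fun _ _ h => cylinderAlgebra_le fun _ hi j => measurableSet_preimage_piece hA (hi.trans_le h) j

lemma cylinderAlgebra_le_top (n : ℕ) : cylinderAlgebra T A n ≤ cylinderAlgebraTop T A :=
  MeasurableSpace.generateFrom_mono (subset_iUnion _ n)

lemma cylinderAlgebra_le_measurable [M : MeasurableSpace Ω] (hT : Measurable T)
    (hA : ∀ i, MeasurableSet (A i)) (n : ℕ) : cylinderAlgebra T A n ≤ M :=
  cylinderAlgebra_le fun i _ j => hT.iterate i (hA j)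

lemma measurableSet_preimage_iterate (hA : ⋃ i, A i = univ) {n i n' : ℕ} (h : i + n ≤ n')
    {S : Set Ω} (hS : MeasurableSet[cylinderAlgebra T A n] S) :
    MeasurableSet[cylinderAlgebra T A n'] (T^[i] ⁻¹' S) := by
  have hle : cylinderAlgebra T A n ≤ (cylinderAlgebra T A n').map T^[i] := by
    refine cylinderAlgebra_le fun l hl j => ?_
    rw [MeasurableSpace.map_def, ← preimage_comp, ← Function.iterate_add]
    exact measurableSet_preimage_piece hA (by omega) j
  exact hle _ hS

lemma countable_cylinders (n : ℕ) : (cylinders T A n).Countable := countable_range _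

lemma exists_mem_cylinders (hA : ⋃ i, A i = univ) (n : ℕ) (x : Ω) :
    ∃ C ∈ cylinders T A n, x ∈ C := by
  choose f hf using iUnion_eq_univ_iff.1 hA
  exact ⟨_, ⟨fun i => f (T^[(i : ℕ)] x), rfl⟩, mem_iInter.2 fun i => hf _⟩

end Cylinders

section Avoid

variable {Ω : Type*} {T : Ω → Ω} {U V : Set Ω} {t : ℕ}

/-- The event `τ_U > t`: the points whose orbit avoids `U` at the times `1, …, t`. -/
def avoid (T : Ω → Ω) (U : Set Ω) (t : ℕ) : Set Ω := {x | ∀ j, 1 ≤ j → j ≤ t → T^[j] x ∉ U}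

lemma notMem_avoid {x : Ω} : x ∉ avoid T U t ↔ ∃ j, 1 ≤ j ∧ j ≤ t ∧ T^[j] x ∈ U := by
  simp [avoid]

@[simp] lemma avoid_zero : avoid T U 0 = univ :=
  eq_univ_of_forall fun _ _ h1 h2 => by omega

lemma avoid_one : avoid T U 1 = T ⁻¹' Uᶜ := by
  ext x
  exact ⟨fun hx => hx 1 le_rfl le_rfl, fun hx j h1 h2 => le_antisymm h1 h2 ▸ hx⟩

lemma avoid_add (s t : ℕ) : avoid T U (s + t) = avoid T U s ∩ T^[s] ⁻¹' avoid T U t := by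
  ext x
  simp only [avoid, mem_inter_iff, mem_preimage, mem_ofPred_eq, ← Function.iterate_add_apply]
  refine ⟨fun h => ⟨fun j h1 h2 => h j h1 (by omega), fun j h1 h2 => h _ (by omega) (by omega)⟩,
    fun ⟨hs, ht⟩ j h1 h2 => ?_⟩
  obtain hj | hj := le_or_gt j s
  · exact hs j h1 hj
  · simpa only [Nat.sub_add_cancel hj.le] using ht (j - s) (by omega) (by omega)

lemma preimage_avoid_inter_subset (W : Set Ω) (J e : ℕ) :
    T^[e] ⁻¹' (avoid T U J ∩ T^[J + 1] ⁻¹' W) ⊆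
      avoid T U (J + e) ∩ T^[J + e + 1] ⁻¹' W ∪ (avoid T U e)ᶜ ∩ T^[J + e + 1] ⁻¹' W := by
  rw [preimage_inter, ← preimage_comp, ← Function.iterate_add, add_right_comm,
    ← union_inter_distrib_right, add_comm J e, avoid_add]
  exact inter_subset_inter_left _ fun x hx => or_iff_not_imp_right.2 fun h => ⟨not_not.1 h, hx⟩

lemma avoid_anti_set (h : U ⊆ V) (t : ℕ) : avoid T V t ⊆ avoid T U t :=
  fun _ hx j h1 h2 hU => hx j h1 h2 (h hU)

lemma antitone_avoid : Antitone (avoid T U) :=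
  fun _ _ h _ hx j h1 h2 => hx j h1 (h2.trans h)

lemma measurableSet_avoid [MeasurableSpace Ω]
    (h : ∀ j, 1 ≤ j → j ≤ t → MeasurableSet (T^[j] ⁻¹' U)) : MeasurableSet (avoid T U t) := by
  have h_inter : avoid T U t = ⋂ j ∈ Finset.Icc 1 t, (T^[j] ⁻¹' U)ᶜ := by
    ext x
    simp [avoid]
  rw [h_inter]
  refine Finset.measurableSet_biInter _ fun j hj => ?_
  obtain ⟨h1, h2⟩ := Finset.mem_Icc.1 hj
  exact (h j h1 h2).compl

lemma measurableSet_cylinderAlgebra_avoid {A : ℕ → Set Ω} (hA : ⋃ i, A i = univ) {n : ℕ}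
    (hU : MeasurableSet[cylinderAlgebra T A n] U) (t : ℕ) :
    MeasurableSet[cylinderAlgebra T A (t + n)] (avoid T U t) :=
  @measurableSet_avoid _ _ _ _ (cylinderAlgebra T A _) fun _ _ _ =>
    measurableSet_preimage_iterate hA (by omega) hU

lemma le_hittingTime_iff {x : Ω} {N : ℕ∞} :
    N ≤ hittingTime T U x ↔ ∀ j : ℕ, 1 ≤ j → T^[j] x ∈ U → N ≤ j := by
  simp [hittingTime]

lemma survival_eq [MeasurableSpace Ω] {μ : Measure Ω} {t : ℝ} (ht : 0 ≤ t) :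
    survival μ T U t = μ.real (avoid T U ⌊t⌋₊) := by
  have h_lt (x : Ω) : ENNReal.ofReal t < (hittingTime T U x : ℝ≥0∞) ↔
      ((⌊t⌋₊ + 1 : ℕ) : ℕ∞) ≤ hittingTime T U x := by
    cases hittingTime T U x with
    | top => simp
    | coe a =>
      rw [ENat.toENNReal_coe, Nat.cast_le, ← ENNReal.ofReal_natCast,
        ENNReal.ofReal_lt_ofReal_iff_of_nonneg ht, Nat.succ_le_iff, Nat.floor_lt ht]
  unfold survival
  congr 1
  ext x
  rw [mem_ofPred_eq, h_lt, le_hittingTime_iff]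
  simp only [Nat.cast_le, Nat.succ_le_iff, avoid, mem_ofPred_eq]
  exact forall₂_congr fun j _ => ⟨fun h hj hU => (h hU).not_ge hj, fun h hU =>
    not_le.1 fun hj => h hj hU⟩

end Avoid

section Invariant

variable {Ω : Type*} [MeasurableSpace Ω] {μ : Measure Ω} {T : Ω → Ω} {U V : Set Ω}

lemma measureReal_preimage_iterate (hμ : MeasurePreserving T μ μ) {S : Set Ω}
    (hS : MeasurableSet S) (i : ℕ) : μ.real (T^[i] ⁻¹' S) = μ.real S :=
  (hμ.iterate i).measureReal_preimage hS.nullMeasurableSet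

lemma measurableSet_avoid_of_measurable (hT : Measurable T) (hU : MeasurableSet U) (t : ℕ) :
    MeasurableSet (avoid T U t) :=
  measurableSet_avoid fun j _ _ => hT.iterate j hU

lemma measureReal_inter_avoid [IsFiniteMeasure μ] (hμ : MeasurePreserving T μ μ)
    (hU : MeasurableSet U) (t : ℕ) :
    μ.real (U ∩ avoid T U t) = μ.real (avoid T U t) - μ.real (avoid T U (t + 1)) := by
  have h_meas := measurableSet_avoid_of_measurable hμ.measurable hU t
  have h_succ : avoid T U (t + 1) = T ⁻¹' (avoid T U t \ U) := by
    rw [add_comm, avoid_add, avoid_one, Function.iterate_one, inter_comm, ← preimage_inter,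
      Set.sdiff_eq]
  rw [h_succ, hμ.measureReal_preimage (h_meas.diff hU).nullMeasurableSet, inter_comm,
    ← measureReal_inter_add_sdiff (μ := μ) (s := avoid T U t) hU, add_sub_cancel_right]

lemma measureReal_avoid_inter_preimage [IsFiniteMeasure μ] (hμ : MeasurePreserving T μ μ)
    (hU : MeasurableSet U) (t : ℕ) :
    μ.real (avoid T U t ∩ T^[t + 1] ⁻¹' U) = μ.real (U ∩ avoid T U t) := by
  have h_meas := measurableSet_avoid_of_measurable hμ.measurable hU
  rw [measureReal_inter_avoid hμ hU,
    ← measureReal_sdiff (antitone_avoid (Nat.le_add_right t 1)) (h_meas (t + 1)), avoid_add,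
    sdiff_self_inter, avoid_one, preimage_compl, preimage_compl, sdiff_compl,
    ← preimage_comp, ← Function.iterate_succ']

lemma one_sub_measureReal_avoid [IsProbabilityMeasure μ] (hμ : MeasurePreserving T μ μ)
    (hU : MeasurableSet U) (t : ℕ) :
    1 - μ.real (avoid T U t) = ∑ i ∈ Finset.range t, μ.real (U ∩ avoid T U i) := by
  simp only [measureReal_inter_avoid hμ hU, Finset.sum_range_sub', avoid_zero, probReal_univ]

lemma measureReal_avoid_sub_le [IsFiniteMeasure μ] (hμ : MeasurePreserving T μ μ)
    (hU : MeasurableSet U) (hV : MeasurableSet V) (hUV : U ⊆ V) (t : ℕ) :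
    μ.real (avoid T U t) - μ.real (avoid T V t) ≤ t * (μ.real V - μ.real U) := by
  have h_sub : avoid T U t ⊆ avoid T V t ∪ ⋃ j ∈ Finset.Icc 1 t, T^[j] ⁻¹' (V \ U) := by
    refine fun x hx => or_iff_not_imp_left.2 fun h => ?_
    obtain ⟨j, h1, h2, hj⟩ := notMem_avoid.1 h
    exact mem_biUnion (Finset.mem_coe.2 (Finset.mem_Icc.2 ⟨h1, h2⟩)) ⟨hj, hx j h1 h2⟩
  have h_union : μ.real (⋃ j ∈ Finset.Icc 1 t, T^[j] ⁻¹' (V \ U)) ≤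
      t * (μ.real V - μ.real U) := by
    refine (measureReal_biUnion_finset_le _ _).trans ?_
    simp only [measureReal_preimage_iterate hμ (hV.diff hU),
      measureReal_sdiff (μ := μ) hUV hU, Finset.sum_const, Nat.card_Icc, add_tsub_cancel_right,
      nsmul_eq_mul, le_refl]
  linarith [(measureReal_mono (μ := μ) h_sub).trans (measureReal_union_le _ _)]

lemma abs_measureReal_inter_avoid_sub_le [IsFiniteMeasure μ] (hμ : MeasurePreserving T μ μ)
    (hU : MeasurableSet U) (hV : MeasurableSet V) (hUV : U ⊆ V) (t : ℕ) :
    |μ.real (U ∩ avoid T U t) - μ.real (V ∩ avoid T V t)| ≤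
      (t + 1) * (μ.real V - μ.real U) := by
  have h_time := measureReal_avoid_sub_le hμ hU hV hUV t
  have h_time_succ := measureReal_avoid_sub_le hμ hU hV hUV (t + 1)
  have h_anti := measureReal_mono (μ := μ) (avoid_anti_set (T := T) hUV t)
  have h_anti_succ := measureReal_mono (μ := μ) (avoid_anti_set (T := T) hUV (t + 1))
  have h_mono := measureReal_mono (μ := μ) hUV
  rw [measureReal_inter_avoid hμ hU, measureReal_inter_avoid hμ hV, abs_le]
  push_cast at h_time_succ
  constructor <;> linarith

end Invariant

section Mixing

variable {Ω : Type*} [MeasurableSpace Ω] {μ : Measure Ω} {T : Ω → Ω} {A : ℕ → Set Ω} {φ : ℕ → ℝ}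
  {U : Set Ω} {n : ℕ}

lemma IsRightPhiMixing.nonneg (hmix : IsRightPhiMixing μ T A φ) (k : ℕ) : 0 ≤ φ k :=
  hmix.antitone.le_of_tendsto hmix.tendsto_zero k

variable [IsProbabilityMeasure μ]

lemma measureReal_avoid_add_le (hA : IsMeasurablePartition A) (hmix : IsRightPhiMixing μ T A φ)
    (hU : MeasurableSet[cylinderAlgebra T A n] U) (D k t : ℕ) :
    μ.real (avoid T U (D + (n + k) + t)) ≤
      (μ.real (avoid T U D) + φ k) * μ.real (avoid T U t) := by
  have h_meas := measurableSet_cylinderAlgebra_avoid hA.iUnion_eq hU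
  have h_mix := hmix.mixing _ k _ _ (h_meas D) (cylinderAlgebra_le_top _ _ (h_meas t))
  have h_sub : avoid T U (D + (n + k) + t) ⊆ avoid T U D ∩ T^[D + n + k] ⁻¹' avoid T U t := by
    rw [avoid_add, ← add_assoc]
    exact inter_subset_inter_left _ (antitone_avoid (by omega))
  linarith [measureReal_mono (μ := μ) h_sub, (abs_le.1 h_mix).2]

lemma le_measureReal_avoid_add (hμ : MeasurePreserving T μ μ) (hA : IsMeasurablePartition A)
    (hmix : IsRightPhiMixing μ T A φ) (hU : MeasurableSet[cylinderAlgebra T A n] U) (D k t : ℕ) :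
    (μ.real (avoid T U D) - φ k) * μ.real (avoid T U (n + k + t)) -
        (1 - μ.real (avoid T U (n + k)) + φ k) * μ.real (avoid T U t) ≤
      μ.real (avoid T U (D + (n + k) + (n + k + t))) := by
  have hA_le := cylinderAlgebra_le_measurable hμ.measurable hA.measurableSet
  have h_meas := measurableSet_cylinderAlgebra_avoid hA.iUnion_eq hU
  have h_top (t : ℕ) := cylinderAlgebra_le_top _ _ (h_meas t)
  set gap : Set Ω := T^[D] ⁻¹' (avoid T U (n + k))ᶜ with h_gap
  have h_gap_meas : MeasurableSet[cylinderAlgebra T A (D + (n + k + n))] gap :=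
    measurableSet_preimage_iterate hA.iUnion_eq le_rfl (h_meas (n + k)).compl
  have h_gap_measure : μ.real gap = 1 - μ.real (avoid T U (n + k)) := by
    rw [h_gap, measureReal_preimage_iterate hμ (hA_le _ _ (h_meas (n + k)).compl),
      probReal_compl_eq_one_sub (hA_le _ _ (h_meas (n + k)))]
  have h_mix := hmix.mixing _ k _ _ (h_meas D) (h_top (n + k + t))
  have h_mix_gap := hmix.mixing _ k _ _ h_gap_meas (h_top t)
  have h_sub : avoid T U D ∩ T^[D + n + k] ⁻¹' avoid T U (n + k + t) ⊆
      avoid T U (D + (n + k) + (n + k + t)) ∪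
        (gap ∩ T^[D + (n + k + n) + k] ⁻¹' avoid T U t) := by
    rintro x ⟨hxD, hx⟩
    by_cases hgap : x ∈ gap
    · rw [mem_preimage, avoid_add, mem_inter_iff, mem_preimage, ← Function.iterate_add_apply] at hx
      exact Or.inr ⟨hgap, by
        rw [show D + (n + k + n) + k = n + k + (D + n + k) by omega]; exact hx.2⟩
    · rw [avoid_add, avoid_add]
      exact Or.inl ⟨⟨hxD, not_not.1 hgap⟩, by rwa [← add_assoc]⟩
  rw [h_gap_measure] at h_mix_gap
  linarith [(measureReal_mono (μ := μ) h_sub).trans (measureReal_union_le _ _),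
    (abs_le.1 h_mix).1, (abs_le.1 h_mix_gap).2]

/- Reversing time, a visit to `U` that is preceded by another visit `j` steps earlier is preceded
by a visit to `V j ⊇ U`; as `V j` depends on `j / 2` coordinates only, mixing applies to the gap of
length `j / 2` that is left. -/
lemma measureReal_inter_avoid_sub_le (hμ : MeasurePreserving T μ μ)
    (hA : IsMeasurablePartition A) (hmix : IsRightPhiMixing μ T A φ)
    (hU : MeasurableSet[cylinderAlgebra T A n] U) {V : ℕ → Set Ω}
    (hV : ∀ j, MeasurableSet[cylinderAlgebra T A (j / 2)] (V j)) (hUV : ∀ j, U ⊆ V j) (J e : ℕ) :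
    μ.real (U ∩ avoid T U J) - μ.real (U ∩ avoid T U (J + e)) ≤
      (∑ j ∈ Finset.Ioc J (J + e), μ.real (V j) + φ (J / 2)) * μ.real U := by
  have hA_le := cylinderAlgebra_le_measurable hμ.measurable hA.measurableSet
  have hU' : MeasurableSet U := hA_le _ _ hU
  set S : Set Ω := ⋃ j ∈ Finset.Ioc J (J + e), T^[J + e + 1 - j] ⁻¹' V j
  have hS_meas : MeasurableSet[cylinderAlgebra T A (J + e + 1 - J / 2)] S := by
    refine @Finset.measurableSet_biUnion _ _ (cylinderAlgebra T A _) _ _ fun j hj => ?_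
    have := Finset.mem_Ioc.1 hj
    exact measurableSet_preimage_iterate hA.iUnion_eq (by omega) (hV j)
  have hS_measure : μ.real S ≤ ∑ j ∈ Finset.Ioc J (J + e), μ.real (V j) :=
    (measureReal_biUnion_finset_le _ _).trans
      (Finset.sum_le_sum fun j _ => (measureReal_preimage_iterate hμ (hA_le _ _ (hV j)) _).le)
  have h_hit : (avoid T U e)ᶜ ⊆ S := fun x hx => by
    obtain ⟨j, h1, h2, hj⟩ := notMem_avoid.1 hx
    refine mem_biUnion (x := J + e + 1 - j) (Finset.mem_coe.2 (Finset.mem_Ioc.2 (by omega))) ?_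
    rw [mem_preimage, show J + e + 1 - (J + e + 1 - j) = j by omega]
    exact hUV _ hj
  have h_mix := hmix.mixing _ (J / 2) S U hS_meas (cylinderAlgebra_le_top n _ hU)
  rw [show J + e + 1 - J / 2 + J / 2 = J + e + 1 by omega] at h_mix
  have h_le := (measureReal_mono (μ := μ) ((preimage_avoid_inter_subset U J e).trans
    (union_subset_union_right _ (inter_subset_inter_left _ h_hit)))).trans
      (measureReal_union_le _ _)
  rw [measureReal_preimage_iterate hμ ((measurableSet_avoid_of_measurable hμ.measurable hU' J).inter
      (hμ.measurable.iterate _ hU')), measureReal_avoid_inter_preimage hμ hU',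
    measureReal_avoid_inter_preimage hμ hU'] at h_le
  linarith [(abs_le.1 h_mix).2,
    mul_le_mul_of_nonneg_right hS_measure (measureReal_nonneg (μ := μ) (s := U))]

end Mixing

section BlockSequences

/-- The properties of the survival sequence `g t = μ(τ_U > t)` of a set `U ∈ σ(𝒜ⁿ)` with `M = μ(U)`
that determine its exponential rate: the long time intervals of Bernstein's big block – small block
technique decouple across gaps of length `n + k`, up to an error `φ k`. -/
structure IsBlockSeq (g : ℕ → ℝ) (M : ℝ) (n : ℕ) (φ : ℕ → ℝ) : Prop where
  zero : g 0 = 1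
  antitone : Antitone g
  nonneg : ∀ t, 0 ≤ g t
  sub_succ_le : ∀ t, g t - g (t + 1) ≤ M
  add_le : ∀ D k t, g (D + (n + k) + t) ≤ (g D + φ k) * g t
  le_add : ∀ D k t, (g D - φ k) * g (n + k + t) - (1 - g (n + k) + φ k) * g t ≤
    g (D + (n + k) + (n + k + t))

lemma isBlockSeq_avoid {Ω : Type*} [MeasurableSpace Ω] {μ : Measure Ω} [IsProbabilityMeasure μ]
    {T : Ω → Ω} {A : ℕ → Set Ω} {φ : ℕ → ℝ} {U : Set Ω} {n : ℕ} (hμ : MeasurePreserving T μ μ)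
    (hA : IsMeasurablePartition A) (hmix : IsRightPhiMixing μ T A φ)
    (hU : MeasurableSet[cylinderAlgebra T A n] U) :
    IsBlockSeq (fun t => μ.real (avoid T U t)) (μ.real U) n φ where
  zero := by simp only [avoid_zero, probReal_univ]
  antitone _ _ h := measureReal_mono (antitone_avoid h)
  nonneg _ := measureReal_nonneg
  sub_succ_le t := by
    rw [← measureReal_inter_avoid hμ
      (cylinderAlgebra_le_measurable hμ.measurable hA.measurableSet _ _ hU)]
    exact measureReal_mono inter_subset_left
  add_le := measureReal_avoid_add_le hA hmix hU
  le_add := le_measureReal_avoid_add hμ hA hmix hU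

namespace IsBlockSeq

variable {g : ℕ → ℝ} {M : ℝ} {n : ℕ} {φ : ℕ → ℝ} (h : IsBlockSeq g M n φ)
include h

lemma le_one (t : ℕ) : g t ≤ 1 := h.zero ▸ h.antitone t.zero_le

lemma M_nonneg : 0 ≤ M := (sub_nonneg.2 (h.antitone (Nat.le_succ 0))).trans (h.sub_succ_le 0)

lemma sub_add_le (t w : ℕ) : g t - g (t + w) ≤ w * M := by
  induction w with
  | zero => simp
  | succ w ih =>
    rw [← add_assoc]
    push_cast
    linarith [h.sub_succ_le (t + w)]

lemma one_sub_mul_le {D k : ℕ} {x : ℝ} (hφ : 0 ≤ φ k)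
    (hx : 1 - g D + 3 * φ k + 2 * (((n + k : ℕ) : ℝ) * M) ≤ x) (hx1 : x ≤ 1 / 2) (j : ℕ) :
    (1 - x) * g (j * (D + (n + k))) ≤ g ((j + 1) * (D + (n + k))) := by
  have hM := h.M_nonneg
  have h_gap_nonneg : 0 ≤ ((n + k : ℕ) : ℝ) * M := by positivity
  have h_gap : 1 - g (n + k) ≤ (n + k : ℕ) * M := by
    simpa only [h.zero, zero_add] using h.sub_add_le 0 (n + k)
  induction j with
  | zero =>
    simp only [zero_mul, h.zero, zero_add, one_mul, mul_one]
    linarith [h.sub_add_le D (n + k)]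
  | succ j ih =>
    set W := D + (n + k) with hW
    have h_add := h.le_add D k (j * W + D)
    rw [show n + k + (j * W + D) = (j + 1) * W by rw [hW]; ring,
      show D + (n + k) + (j + 1) * W = (j + 1 + 1) * W by rw [hW]; ring] at h_add
    have h_prev : g (j * W + D) ≤ 2 * g ((j + 1) * W) := by
      have := h.antitone (Nat.le_add_right (j * W) D)
      nlinarith [h.nonneg (j * W)]
    have h_err : (1 - g (n + k) + φ k) * g (j * W + D) ≤
        ((n + k : ℕ) * M + φ k) * (2 * g ((j + 1) * W)) := by
      gcongr
      exact h.nonneg _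
    linarith [mul_le_mul_of_nonneg_right hx (h.nonneg ((j + 1) * W))]

lemma one_sub_pow_le {D k : ℕ} {x : ℝ} (hφ : 0 ≤ φ k)
    (hx : 1 - g D + 3 * φ k + 2 * (((n + k : ℕ) : ℝ) * M) ≤ x) (hx1 : x ≤ 1 / 2) (j : ℕ) :
    (1 - x) ^ j ≤ g (j * (D + (n + k))) := by
  induction j with
  | zero => simp [h.zero]
  | succ j ih =>
    rw [pow_succ']
    exact (mul_le_mul_of_nonneg_left ih (by linarith)).trans (h.one_sub_mul_le hφ hx hx1 j)

lemma le_pow {D k : ℕ} (hφ : 0 ≤ φ k) (j : ℕ) : g (j * (D + (n + k))) ≤ (g D + φ k) ^ j := by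
  induction j with
  | zero => simp [h.zero]
  | succ j ih =>
    rw [pow_succ', add_one_mul, add_comm]
    exact (h.add_le D k _).trans (mul_le_mul_of_nonneg_left ih (add_nonneg (h.nonneg _) hφ))

lemma neg_log_le {D k : ℕ} {x : ℝ} (hφ : 0 ≤ φ k)
    (hx : 1 - g D + 3 * φ k + 2 * (((n + k : ℕ) : ℝ) * M) ≤ x) (hx1 : x ≤ 1 / 2)
    (hW : 0 < D + (n + k)) (t : ℕ) :
    0 < g t ∧ -Real.log (g t) ≤ ((t : ℝ) / (D + (n + k) : ℕ) + 1) * (x / (1 - x)) := by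
  set W := D + (n + k)
  have hx0 : 0 ≤ x := by
    have := mul_nonneg (Nat.cast_nonneg (α := ℝ) (n + k)) h.M_nonneg
    linarith [h.le_one D]
  have hx_lt : 0 < 1 - x := by linarith
  have h_pow : (1 - x) ^ (t / W + 1) ≤ g t := (h.one_sub_pow_le hφ hx hx1 _).trans
    (h.antitone (mul_comm W _ ▸ (Nat.lt_mul_div_succ t hW).le))
  have h_pos : 0 < (1 - x) ^ (t / W + 1) := pow_pos hx_lt _
  have h_log := Real.log_le_log h_pos h_pow
  rw [Real.log_pow] at h_log
  have h_one_sub : -Real.log (1 - x) ≤ x / (1 - x) := by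
    have h_inv : x / (1 - x) = (1 - x)⁻¹ - 1 := by field_simp; ring
    linarith [Real.one_sub_inv_le_log_of_pos hx_lt]
  refine ⟨h_pos.trans_le h_pow, ?_⟩
  calc -Real.log (g t) ≤ ((t / W + 1 : ℕ) : ℝ) * -Real.log (1 - x) := by linarith
    _ ≤ ((t / W : ℕ) + 1) * (x / (1 - x)) := by push_cast; gcongr
    _ ≤ ((t : ℝ) / W + 1) * (x / (1 - x)) := by gcongr; exact Nat.cast_div_le

lemma le_neg_log {D k : ℕ} (hφ : 0 ≤ φ k) {t : ℕ} (hg : 0 < g t) :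
    (t : ℝ) / (D + (n + k) : ℕ) * (1 - (g D + φ k)) - |1 - (g D + φ k)| ≤ -Real.log (g t) := by
  set W := D + (n + k)
  set y := 1 - (g D + φ k)
  have h_exp : g t ≤ Real.exp (-y) ^ (t / W) :=
    (h.antitone (Nat.div_mul_le_self t W)).trans <| (h.le_pow hφ _).trans <|
      pow_le_pow_left₀ (add_nonneg (h.nonneg _) hφ) (by linarith [Real.add_one_le_exp (-y)]) _
  rw [← Real.exp_nat_mul, ← Real.log_le_iff_le_exp hg] at h_exp
  have h_floor : |(t : ℝ) / W - (t / W : ℕ)| ≤ 1 := by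
    rw [← Nat.floor_div_eq_div (K := ℝ),
      abs_of_nonneg (sub_nonneg.2 (Nat.floor_le (by positivity)))]
    linarith [Nat.lt_floor_add_one ((t : ℝ) / W)]
  have h_frac : ((t : ℝ) / W - (t / W : ℕ)) * y ≤ |y| :=
    (le_abs_self _).trans (abs_mul _ y ▸ mul_le_of_le_one_left (abs_nonneg y) h_floor)
  linarith

lemma neg_log_bounds {D k : ℕ} {x y s : ℝ} (hφ : 0 ≤ φ k)
    (hx : 1 - g D + 3 * φ k + 2 * (((n + k : ℕ) : ℝ) * M) ≤ x) (hx1 : x ≤ 1 / 2)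
    (hy : y ≤ 1 - (g D + φ k)) (hW : 0 < D + (n + k)) (hs : 0 < s) {t : ℕ} (ht : s ≤ t * M) :
    0 < g t ∧
      -Real.log (g t) ≤
        (1 / ((D + (n + k) : ℕ) * M) + 1 / s) * (x / (1 - x)) * (t * M) ∧
      (1 / ((D + (n + k) : ℕ) * M) * y - x / s) * (t * M) ≤ -Real.log (g t) := by
  have hM : 0 < M := h.M_nonneg.lt_of_ne' fun h0 => by simp [h0] at ht; linarith
  set W := D + (n + k)
  set q : ℝ := t * M with hq_def
  have h_abs : |1 - (g D + φ k)| ≤ x := by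
    have h_gap : 0 ≤ ((n + k : ℕ) : ℝ) * M := by positivity
    rw [abs_le]
    constructor <;> linarith [h.le_one D]
  have hx0 : 0 ≤ x := (abs_nonneg _).trans h_abs
  have h_div : (t : ℝ) / W = 1 / (W * M) * q := by
    rw [hq_def]
    field_simp
  have hqs : 1 ≤ 1 / s * q := by rwa [one_div_mul_eq_div, one_le_div hs]
  obtain ⟨hg, h_log_le⟩ := h.neg_log_le hφ hx hx1 hW t
  have h_le_log := h.le_neg_log (D := D) hφ hg
  rw [h_div] at h_log_le h_le_log
  refine ⟨hg, h_log_le.trans ?_, le_trans ?_ h_le_log⟩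
  · rw [mul_right_comm, add_mul (1 / (W * M))]
    gcongr
    exact div_nonneg hx0 (by linarith)
  · have h_block : 1 / (W * M) * q * y ≤ 1 / (W * M) * q * (1 - (g D + φ k)) := by
      gcongr
    have h_one := mul_le_mul_of_nonneg_left hqs hx0
    rw [sub_mul, mul_right_comm, div_eq_mul_one_div x, mul_assoc x]
    linarith

end IsBlockSeq

end BlockSequences

section ExponentialRate

variable {ι : Type*} {l : Filter ι} {g : ι → ℕ → ℝ} {M : ι → ℝ} {L : ℝ}

/-- `1 - g r t = L t M r (1 + o(1))` as `t → ∞` and `t M r → 0`, jointly along `l`. -/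
def HasFirstOrder (l : Filter ι) (g : ι → ℕ → ℝ) (M : ι → ℝ) (L : ℝ) : Prop :=
  ∀ δ > 0, ∀ᶠ p : ℕ × ι in atTop ×ˢ l,
    |1 - g p.2 p.1 - L * (p.1 * M p.2)| ≤ (δ + p.1 * M p.2) * (p.1 * M p.2)

/-- `-log (g r t) / (t M r) → L` as `t → ∞`, uniformly in `r` along `l`. -/
def HasExpRate (l : Filter ι) (g : ι → ℕ → ℝ) (M : ι → ℝ) (L : ℝ) : Prop :=
  (∀ᶠ p : ℕ × ι in atTop ×ˢ l, 0 < g p.2 p.1) ∧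
    Tendsto (fun p : ℕ × ι => -Real.log (g p.2 p.1) / (p.1 * M p.2)) (atTop ×ˢ l) (𝓝 L)

lemma HasExpRate.comp (h : HasExpRate l g M L) {t : ι → ℕ} (ht : Tendsto t l atTop) :
    Tendsto (fun r => -Real.log (g r (t r)) / (t r * M r)) l (𝓝 L) :=
  h.2.comp (ht.prodMk tendsto_id)

lemma HasExpRate.tendsto_of_tendsto_div (h : HasExpRate l g M L) {M' : ι → ℝ}
    (hM : ∀ᶠ r in l, 0 < M r) (hM' : Tendsto (fun r => M r / M' r) l (𝓝 1)) :
    Tendsto (fun p : ℕ × ι => -Real.log (g p.2 p.1) / (p.1 * M' p.2)) (atTop ×ˢ l) (𝓝 L) := by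
  have h_mul := h.2.mul (hM'.comp tendsto_snd)
  rw [mul_one] at h_mul
  refine h_mul.congr' ?_
  filter_upwards [tendsto_snd.eventually hM] with p hp
  rw [Function.comp_apply, ← mul_div_mul_right _ (p.1 * M' p.2) hp.ne', div_mul_div_comm]
  congr 1
  ring

lemma HasExpRate.squeeze {g₁ g₂ : ι → ℕ → ℝ} {M₁ M₂ : ι → ℝ} (h₁ : HasExpRate l g₁ M₁ L)
    (h₂ : HasExpRate l g₂ M₂ L) (hM : ∀ᶠ r in l, 0 < M r) (hM₁ : ∀ᶠ r in l, 0 < M₁ r)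
    (hM₂ : ∀ᶠ r in l, 0 < M₂ r) (hM₁_div : Tendsto (fun r => M₁ r / M r) l (𝓝 1))
    (hM₂_div : Tendsto (fun r => M₂ r / M r) l (𝓝 1)) (hg₁ : ∀ᶠ r in l, ∀ t, g₁ r t ≤ g r t)
    (hg₂ : ∀ᶠ r in l, ∀ t, g r t ≤ g₂ r t) : HasExpRate l g M L := by
  have h_pos : ∀ᶠ p : ℕ × ι in atTop ×ˢ l, 0 < g p.2 p.1 := by
    filter_upwards [h₁.1, tendsto_snd.eventually hg₁] with p h0 h1 using h0.trans_le (h1 p.1)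
  refine ⟨h_pos, tendsto_of_tendsto_of_tendsto_of_le_of_le'
    (h₂.tendsto_of_tendsto_div hM₂ hM₂_div) (h₁.tendsto_of_tendsto_div hM₁ hM₁_div) ?_ ?_⟩
  · filter_upwards [h_pos, tendsto_snd.eventually hg₂, tendsto_snd.eventually hM] with p hp hle hM
    gcongr
    exact hle p.1
  · filter_upwards [h₁.1, tendsto_snd.eventually hg₁, tendsto_snd.eventually hM] with p hp hle hM
    gcongr
    exact hle p.1

lemma abs_neg_log_sub_le {y : ℝ} (hy : 1 / 2 ≤ y) :
    |-Real.log y - (1 - y)| ≤ 2 * (1 - y) ^ 2 := by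
  have hy0 : 0 < y := by linarith
  have h_lower := Real.log_le_sub_one_of_pos hy0
  have h_upper := Real.one_sub_inv_le_log_of_pos hy0
  have h_inv : y⁻¹ - 1 - (1 - y) ≤ 2 * (1 - y) ^ 2 := by
    have h_eq : y⁻¹ - 1 - (1 - y) = y⁻¹ * (1 - y) ^ 2 := by field_simp
    rw [h_eq]
    gcongr
    exact (inv_le_comm₀ hy0 two_pos).2 (by linarith)
  rw [abs_le]
  constructor <;> linarith [mul_nonneg zero_le_two (sq_nonneg (1 - y))]

lemma tendsto_neg_log_div {f : ι → ℝ} (hM : Tendsto M l (𝓝 0))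
    (hM0 : ∀ᶠ r in l, M r ≠ 0) (hf : Tendsto (fun r => (1 - f r) / M r) l (𝓝 L)) :
    Tendsto (fun r => -Real.log (f r) / M r) l (𝓝 L) := by
  have h_one_sub : Tendsto (fun r => 1 - f r) l (𝓝 0) := by
    have h_mul := hf.mul hM
    rw [mul_zero] at h_mul
    refine h_mul.congr' ?_
    filter_upwards [hM0] with r hr using div_mul_cancel₀ _ hr
  have h_err : Tendsto (fun r => 2 * |(1 - f r) / M r| * |1 - f r|) l (𝓝 0) := by
    simpa using (hf.abs.const_mul 2).mul h_one_sub.abs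
  refine hf.congr_dist (squeeze_zero' (Eventually.of_forall fun _ => dist_nonneg) ?_ h_err)
  filter_upwards [hM0, h_one_sub.eventually_le_const (show (0 : ℝ) < 1 / 2 by norm_num)]
    with r hr hf
  rw [dist_comm, Real.dist_eq, ← sub_div, abs_div, abs_div, mul_assoc, div_mul_eq_mul_div,
    mul_div_assoc', ← sq, sq_abs]
  gcongr
  exact abs_neg_log_sub_le (by linarith)

lemma HasFirstOrder.eventually_of_mul_le (h : HasFirstOrder l g M L) (hM : ∀ᶠ r in l, 0 < M r)
    {ε : ℝ} (hε : 0 < ε) : ∃ c > 0, ∀ᶠ p : ℕ × ι in atTop ×ˢ l, p.1 * M p.2 ≤ c →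
      0 < g p.2 p.1 ∧ |-Real.log (g p.2 p.1) - L * (p.1 * M p.2)| ≤ ε * (p.1 * M p.2) := by
  have h_near : ∀ᶠ c in 𝓝[>] (0 : ℝ), (|L| + (ε / 2 + c)) * c < 1 / 2 ∧
      ε / 2 + c + 2 * (|L| + (ε / 2 + c)) ^ 2 * c < ε := by
    refine (Filter.Eventually.and ?_ ?_).filter_mono nhdsWithin_le_nhds
    · exact ContinuousAt.eventually_lt (by fun_prop) continuousAt_const (by norm_num)
    · exact ContinuousAt.eventually_lt (by fun_prop) continuousAt_const (by simpa using hε)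
  obtain ⟨c, ⟨hc_half, hc_ε⟩, hc⟩ := (h_near.and self_mem_nhdsWithin).exists
  refine ⟨c, hc, ?_⟩
  filter_upwards [h (ε / 2) (half_pos hε), tendsto_snd.eventually hM] with p hp hMp hqc
  set q : ℝ := p.1 * M p.2
  have hq : 0 ≤ q := by positivity
  have h_one_sub : |1 - g p.2 p.1| ≤ (|L| + (ε / 2 + q)) * q := by
    have h_tri := abs_sub_abs_le_abs_sub (1 - g p.2 p.1) (L * q)
    rw [abs_mul, abs_of_nonneg hq] at h_tri
    linarith
  have h_half : |1 - g p.2 p.1| < 1 / 2 :=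
    h_one_sub.trans_lt (lt_of_le_of_lt (by gcongr) hc_half)
  have hg : 1 / 2 ≤ g p.2 p.1 := by linarith [(abs_lt.1 h_half).2]
  refine ⟨by linarith, ?_⟩
  calc |-Real.log (g p.2 p.1) - L * q|
      ≤ |-Real.log (g p.2 p.1) - (1 - g p.2 p.1)| + |1 - g p.2 p.1 - L * q| := abs_sub_le _ _ _
    _ ≤ 2 * ((|L| + (ε / 2 + q)) * q) ^ 2 + (ε / 2 + q) * q := by
        gcongr
        refine (abs_neg_log_sub_le hg).trans ?_
        rw [← sq_abs]
        gcongr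
    _ = (ε / 2 + q + 2 * (|L| + (ε / 2 + q)) ^ 2 * q) * q := by ring
    _ ≤ (ε / 2 + c + 2 * (|L| + (ε / 2 + c)) ^ 2 * c) * q := by gcongr
    _ ≤ ε * q := by gcongr

lemma tendsto_floor_div_atTop (hM : Tendsto M l (𝓝[>] 0)) {η : ℝ} (hη : 0 < η) :
    Tendsto (fun r => ⌊η / M r⌋₊) l atTop := by
  simp only [div_eq_mul_inv]
  exact tendsto_nat_floor_atTop.comp ((tendsto_inv_nhdsGT_zero.comp hM).const_mul_atTop hη)

lemma tendsto_floor_div_mul (hM : Tendsto M l (𝓝[>] 0)) {η : ℝ} (hη : 0 ≤ η) :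
    Tendsto (fun r => ⌊η / M r⌋₊ * M r) l (𝓝 η) := by
  refine ((tendsto_nat_floor_mul_div_atTop hη).comp (tendsto_inv_nhdsGT_zero.comp hM)).congr
    fun r => ?_
  simp only [Function.comp_apply, div_inv_eq_mul, div_eq_mul_inv η]

/- The big blocks have length `D = ⌊η / M⌋` and the gaps length `n + k` with `k = ⌊η² / M⌋`, so that
a block and its gap are `W = D + n + k ∼ η (1 + η) / M` long and the gap is negligible. -/
lemma HasFirstOrder.exists_block {n : ι → ℕ} {φ : ℕ → ℝ} (h : HasFirstOrder l g M L)
    (hM : Tendsto M l (𝓝[>] 0)) (hn : Tendsto (fun r => n r * M r) l (𝓝 0))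
    (hφ : Tendsto φ atTop (𝓝 0)) {η : ℝ} (hη : 0 < η) :
    ∃ D k : ι → ℕ, Tendsto (fun r => (D r + (n r + k r) : ℕ) * M r) l (𝓝 (η * (1 + η))) ∧
      ∀ᶠ r in l, 1 - g r (D r) + 3 * φ (k r) + 2 * ((n r + k r : ℕ) * M r) ≤ η * (L + 5 * η) ∧
        η * (L - 3 * η) ≤ 1 - (g r (D r) + φ (k r)) := by
  have hη2 : 0 < η ^ 2 := by positivity
  refine ⟨fun r => ⌊η / M r⌋₊, fun r => ⌊η ^ 2 / M r⌋₊, ?_⟩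
  have hD := tendsto_floor_div_mul hM hη.le
  have hnk := hn.add (tendsto_floor_div_mul hM hη2.le)
  have hφk := hφ.comp (tendsto_floor_div_atTop hM hη2)
  have h_err := (hD.const_add η).mul hD
  have h_upper := (((hD.const_mul L).add h_err).add (hφk.const_mul 3)).add (hnk.const_mul 2)
  have h_lower := ((hD.const_mul L).sub h_err).sub hφk
  simp only [Nat.cast_add, add_mul]
  refine ⟨by convert hD.add hnk using 2; ring, ?_⟩
  filter_upwards [h_upper.eventually_lt_const (show _ < η * (L + 5 * η) by nlinarith),
    h_lower.eventually_const_lt (show η * (L - 3 * η) < _ by nlinarith),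
    ((tendsto_floor_div_atTop hM hη).prodMk tendsto_id).eventually (h η hη)]
    with r h_upper h_lower h_abs
  rw [abs_le] at h_abs
  simp only [Function.comp_apply, id] at h_upper h_lower h_abs
  constructor <;> linarith

lemma exists_block_scale (L : ℝ) {s ε : ℝ} (hε : 0 < ε) :
    ∃ η > 0, η * (L + 5 * η) < 1 / 2 ∧
      (1 / (η * (1 + η)) + 1 / s) * (η * (L + 5 * η) / (1 - η * (L + 5 * η))) < L + ε ∧
      L - ε < 1 / (η * (1 + η)) * (η * (L - 3 * η)) - η * (L + 5 * η) / s := by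
  have h_near : ∀ᶠ η in 𝓝[>] (0 : ℝ), η * (L + 5 * η) < 1 / 2 ∧
      (1 / (1 + η) + η / s) * ((L + 5 * η) / (1 - η * (L + 5 * η))) < L + ε ∧
      L - ε < (L - 3 * η) / (1 + η) - η * (L + 5 * η) / s := by
    refine (Filter.Eventually.and ?_ (Filter.Eventually.and ?_ ?_)).filter_mono nhdsWithin_le_nhds
    · exact ContinuousAt.eventually_lt (by fun_prop) continuousAt_const (by norm_num)
    · exact ContinuousAt.eventually_lt (by fun_prop (disch := simp)) continuousAt_const
        (by simpa using hε)
    · exact ContinuousAt.eventually_lt continuousAt_const (by fun_prop (disch := simp))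
        (by simpa using hε)
  obtain ⟨η, ⟨h_half, h_upper, h_lower⟩, hη : 0 < η⟩ := (h_near.and self_mem_nhdsWithin).exists
  have h_cancel : 1 / (η * (1 + η)) * η = 1 / (1 + η) := by field_simp
  refine ⟨η, hη, h_half, ?_, ?_⟩
  · rwa [mul_div_assoc, ← mul_assoc, add_mul, h_cancel, one_div_mul_eq_div]
  · rwa [← mul_assoc, h_cancel, one_div_mul_eq_div]

lemma HasFirstOrder.eventually_of_le_mul {n : ι → ℕ} {φ : ℕ → ℝ} (h : HasFirstOrder l g M L)
    (hM : Tendsto M l (𝓝[>] 0)) (hn : Tendsto (fun r => n r * M r) l (𝓝 0))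
    (hφ : Tendsto φ atTop (𝓝 0)) (hφ0 : ∀ k, 0 ≤ φ k)
    (h_block : ∀ᶠ r in l, IsBlockSeq (g r) (M r) (n r) φ) {s ε : ℝ} (hs : 0 < s) (hε : 0 < ε) :
    ∀ᶠ r in l, ∀ t : ℕ, s ≤ t * M r →
      0 < g r t ∧ |-Real.log (g r t) - L * (t * M r)| ≤ ε * (t * M r) := by
  obtain ⟨η, hη, hx_half, h_upper, h_lower⟩ := exists_block_scale L (s := s) hε
  obtain ⟨D, k, hW, h_ineq⟩ := h.exists_block hM hn hφ hη
  have h_inv := (tendsto_const_nhds (x := (1 : ℝ))).div hW (by positivity)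
  filter_upwards [h_block, h_ineq, hM self_mem_nhdsWithin,
    hW.eventually_const_lt (show 0 < η * (1 + η) by positivity),
    ((h_inv.add_const (1 / s)).mul_const _).eventually_lt_const h_upper,
    ((h_inv.mul_const _).sub_const _).eventually_const_lt h_lower]
    with r h_block ⟨hx, hy⟩ (hMr : 0 < M r) hW h_upper h_lower t ht
  have hq : 0 ≤ t * M r := hs.le.trans ht
  obtain ⟨hg, h_log_le, h_le_log⟩ := h_block.neg_log_bounds (hφ0 _) hx hx_half.le hy
    (by exact_mod_cast pos_of_mul_pos_left hW hMr.le) hs ht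
  refine ⟨hg, abs_sub_le_iff.2 ⟨?_, ?_⟩⟩
  · linarith [h_log_le.trans (mul_le_mul_of_nonneg_right h_upper.le hq)]
  · linarith [(mul_le_mul_of_nonneg_right h_lower.le hq).trans h_le_log]

theorem HasFirstOrder.hasExpRate {n : ι → ℕ} {φ : ℕ → ℝ} (h : HasFirstOrder l g M L)
    (hM : Tendsto M l (𝓝[>] 0)) (hn : Tendsto (fun r => n r * M r) l (𝓝 0))
    (hφ : Tendsto φ atTop (𝓝 0)) (hφ0 : ∀ k, 0 ≤ φ k)
    (h_block : ∀ᶠ r in l, IsBlockSeq (g r) (M r) (n r) φ) : HasExpRate l g M L := by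
  have hM_pos : ∀ᶠ r in l, 0 < M r := hM self_mem_nhdsWithin
  have h_approx {ε : ℝ} (hε : 0 < ε) : ∀ᶠ p : ℕ × ι in atTop ×ˢ l,
      0 < g p.2 p.1 ∧ |-Real.log (g p.2 p.1) - L * (p.1 * M p.2)| ≤ ε * (p.1 * M p.2) := by
    obtain ⟨c, hc, h_small⟩ := h.eventually_of_mul_le hM_pos hε
    filter_upwards [h_small,
      tendsto_snd.eventually (h.eventually_of_le_mul hM hn hφ hφ0 h_block hc hε)]
      with p h_small h_large using (le_total (p.1 * M p.2) c).elim h_small (h_large p.1)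
  refine ⟨(h_approx one_pos).mono fun _ hp => hp.1, Metric.tendsto_nhds.2 fun ε hε => ?_⟩
  filter_upwards [h_approx (half_pos hε), tendsto_fst.eventually (eventually_gt_atTop 0),
    tendsto_snd.eventually hM_pos] with p hp (ht : 0 < p.1) hMp
  have hq : 0 < p.1 * M p.2 := by positivity
  rw [Real.dist_eq, div_sub' hq.ne', abs_div, abs_of_pos hq, div_lt_iff₀ hq, mul_comm _ L]
  exact hp.2.trans_lt (by gcongr; exact half_lt_self hε)

end ExponentialRate

section ExtremalIndex

variable {Ω : Type*} [MeasurableSpace Ω] {μ : Measure Ω} {T : Ω → Ω} {U : Set Ω}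

/-- The proportion of the points of `U` that do not return to `U` up to time `J`. -/
def escapeRatio (μ : Measure Ω) (T : Ω → Ω) (U : Set Ω) (J : ℕ) : ℝ :=
  μ.real (U ∩ avoid T U J) / μ.real U

lemma escapeRatio_nonneg (J : ℕ) : 0 ≤ escapeRatio μ T U J :=
  div_nonneg measureReal_nonneg measureReal_nonneg

lemma escapeRatio_le_one [IsFiniteMeasure μ] (J : ℕ) : escapeRatio μ T U J ≤ 1 :=
  div_le_one_of_le₀ (measureReal_mono inter_subset_left) measureReal_nonneg

lemma antitone_escapeRatio [IsFiniteMeasure μ] : Antitone (escapeRatio μ T U) := fun _ _ h =>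
  div_le_div_of_nonneg_right (measureReal_mono (inter_subset_inter_right _ (antitone_avoid h)))
    measureReal_nonneg

lemma measureReal_mul_escapeRatio [IsFiniteMeasure μ] (J : ℕ) :
    μ.real U * escapeRatio μ T U J = μ.real (U ∩ avoid T U J) :=
  mul_div_cancel_of_imp' fun h0 => measureReal_mono_null inter_subset_left h0

lemma one_sub_measureReal_avoid_eq_mul_sum [IsProbabilityMeasure μ]
    (hμ : MeasurePreserving T μ μ) (hU : MeasurableSet U) (t : ℕ) :
    1 - μ.real (avoid T U t) = μ.real U * ∑ i ∈ Finset.range t, escapeRatio μ T U i := by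
  simp only [one_sub_measureReal_avoid hμ hU, Finset.mul_sum, measureReal_mul_escapeRatio]

variable {ι : Type*} {l : Filter ι} {V : ι → Set Ω} {L : ℝ}

/-- The sets `V r` have extremal index `L` along `l`: `L` is the limit, as `J → ∞`, of the
asymptotic proportion of points that do not return up to time `J`. -/
def HasExtremalIndex (μ : Measure Ω) (T : Ω → Ω) (l : Filter ι) (V : ι → Set Ω) (L : ℝ) : Prop :=
  ∃ q : ℕ → ℝ, (∀ J, Tendsto (fun r => escapeRatio μ T (V r) J) l (𝓝 (q J))) ∧
    Tendsto q atTop (𝓝 L)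

/-- Returns to `V r` come in clusters of bounded length: first returns between the times `J` and
`J + e` are rare if `J` is large, up to the rate `e * μ (V r)` of independent returns. -/
def HasFiniteClusters (μ : Measure Ω) (T : Ω → Ω) (l : Filter ι) (V : ι → Set Ω) : Prop :=
  ∀ δ > 0, ∀ᶠ J in atTop, ∀ᶠ r in l, ∀ e : ℕ,
    escapeRatio μ T (V r) J - escapeRatio μ T (V r) (J + e) ≤ δ + e * μ.real (V r)

lemma sum_ite_lt_le {X : ℝ} (hX : 0 ≤ X) (s : Finset ℕ) (b : ℕ) :
    ∑ i ∈ s, (if i < b then X else 0) ≤ b * X := by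
  rw [← Finset.sum_filter, Finset.sum_const, nsmul_eq_mul]
  gcongr
  have h_sub : s.filter (· < b) ⊆ Finset.range b := fun i hi =>
    Finset.mem_range.2 (Finset.mem_filter.1 hi).2
  exact (Finset.card_le_card h_sub).trans (Finset.card_range b).le

lemma abs_sum_sub_le {q : ℕ → ℝ} (hq : Antitone q) (hq0 : ∀ i, 0 ≤ q i) (hq1 : ∀ i, q i ≤ 1)
    {J : ℕ} {δ M : ℝ} (hM : 0 ≤ M) (hJL : |q J - L| ≤ δ)
    (hJ : ∀ e : ℕ, q J - q (J + e) ≤ δ + e * M) (t : ℕ) :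
    |∑ i ∈ Finset.range t, q i - t * L| ≤ J * (1 + |L|) + t * (2 * δ + t * M) := by
  have hδ : 0 ≤ δ := (abs_nonneg _).trans hJL
  have h_term : ∀ i ∈ Finset.range t,
      |q i - L| ≤ (if i < J then 1 + |L| else 0) + (2 * δ + t * M) := by
    intro i hi
    obtain hiJ | hiJ := lt_or_ge i J
    · have h_tri := abs_sub (q i) L
      rw [abs_of_nonneg (hq0 i)] at h_tri
      rw [if_pos hiJ]
      have h_err : 0 ≤ 2 * δ + t * M := by positivity
      linarith [hq1 i]
    · have h_drop : q J - q i ≤ δ + t * M := by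
        have h_le := hJ (i - J)
        rw [Nat.add_sub_of_le hiJ] at h_le
        refine h_le.trans ?_
        gcongr
        exact (Nat.sub_le i J).trans (Finset.mem_range.1 hi).le
      have h_gap : 0 ≤ t * M := by positivity
      rw [if_neg hiJ.not_gt, zero_add, abs_le]
      constructor <;> linarith [hq hiJ, abs_le.1 hJL]
  calc |∑ i ∈ Finset.range t, q i - t * L| = |∑ i ∈ Finset.range t, (q i - L)| := by
        simp only [Finset.sum_sub_distrib, Finset.sum_const, Finset.card_range, nsmul_eq_mul]
    _ ≤ ∑ i ∈ Finset.range t, ((if i < J then 1 + |L| else 0) + (2 * δ + t * M)) :=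
        (Finset.abs_sum_le_sum_abs _ _).trans (Finset.sum_le_sum h_term)
    _ ≤ J * (1 + |L|) + t * (2 * δ + t * M) := by
        rw [Finset.sum_add_distrib, Finset.sum_const, Finset.card_range, nsmul_eq_mul]
        gcongr
        exact sum_ite_lt_le (by positivity) _ _

lemma HasExtremalIndex.exists_abs_sub_le (h : HasExtremalIndex μ T l V L)
    (h_clusters : HasFiniteClusters μ T l V) {δ : ℝ} (hδ : 0 < δ) :
    ∃ J, ∀ᶠ r in l, |escapeRatio μ T (V r) J - L| ≤ δ ∧
      ∀ e : ℕ, escapeRatio μ T (V r) J - escapeRatio μ T (V r) (J + e) ≤ δ + e * μ.real (V r) := by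
  obtain ⟨q, hq, hqL⟩ := h
  obtain ⟨J, hJL, hJ⟩ :=
    ((Metric.tendsto_nhds.1 hqL δ hδ).and (h_clusters δ hδ)).exists
  refine ⟨J, ?_⟩
  filter_upwards [((hq J).sub_const L).abs.eventually_lt_const hJL, hJ] with r hr hJr
  exact ⟨hr.le, hJr⟩

lemma HasExtremalIndex.hasFirstOrder [IsProbabilityMeasure μ] (hμ : MeasurePreserving T μ μ)
    (h : HasExtremalIndex μ T l V L) (h_clusters : HasFiniteClusters μ T l V)
    (hV : ∀ᶠ r in l, MeasurableSet (V r)) :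
    HasFirstOrder l (fun r t => μ.real (avoid T (V r) t)) (fun r => μ.real (V r)) L := by
  intro δ hδ
  obtain ⟨J, hJ⟩ := h.exists_abs_sub_le h_clusters (show 0 < δ / 4 by positivity)
  have h_large : ∀ᶠ t : ℕ in atTop, J * (1 + |L|) ≤ t * (δ / 2) :=
    (tendsto_natCast_atTop_atTop.atTop_mul_const (half_pos hδ)).eventually_ge_atTop _
  filter_upwards [tendsto_fst.eventually h_large, tendsto_snd.eventually (hJ.and hV)]
    with p ht ⟨⟨hJL, hJ⟩, hV⟩
  have h_sum := abs_sum_sub_le antitone_escapeRatio escapeRatio_nonneg escapeRatio_le_one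
    measureReal_nonneg hJL hJ p.1
  rw [one_sub_measureReal_avoid_eq_mul_sum hμ hV,
    show L * (p.1 * μ.real (V p.2)) = μ.real (V p.2) * (p.1 * L) by ring, ← mul_sub, abs_mul,
    abs_of_nonneg measureReal_nonneg]
  calc _ ≤ μ.real (V p.2) * (p.1 * (δ + p.1 * μ.real (V p.2))) :=
        mul_le_mul_of_nonneg_left (by linarith) measureReal_nonneg
    _ = _ := by ring

lemma abs_escapeRatio_sub_le [IsFiniteMeasure μ] (hμ : MeasurePreserving T μ μ) {B : Set Ω}
    (hU : MeasurableSet U) (hB : MeasurableSet B) (hUB : U ⊆ B ∨ B ⊆ U) (hB0 : 0 < μ.real B)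
    (J : ℕ) :
    |μ.real U / μ.real B * escapeRatio μ T U J - escapeRatio μ T B J| ≤
      (J + 1) * |1 - μ.real U / μ.real B| := by
  have h_abs : |μ.real (U ∩ avoid T U J) - μ.real (B ∩ avoid T B J)| ≤
      (J + 1) * |μ.real B - μ.real U| := by
    obtain hUB | hBU := hUB
    · exact (abs_measureReal_inter_avoid_sub_le hμ hU hB hUB J).trans
        (by gcongr; exact le_abs_self _)
    · rw [abs_sub_comm, abs_sub_comm (μ.real B)]
      exact (abs_measureReal_inter_avoid_sub_le hμ hB hU hBU J).trans
        (by gcongr; exact le_abs_self _)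
  rw [div_mul_eq_mul_div, measureReal_mul_escapeRatio, escapeRatio, ← sub_div,
    one_sub_div hB0.ne', abs_div, abs_div, abs_of_pos hB0, mul_div_assoc']
  gcongr

lemma HasExtremalIndex.of_nested [IsFiniteMeasure μ] (hμ : MeasurePreserving T μ μ)
    {B : ι → Set Ω} (h : HasExtremalIndex μ T l B L) (hV : ∀ᶠ r in l, MeasurableSet (V r))
    (hB : ∀ᶠ r in l, MeasurableSet (B r)) (hB0 : ∀ᶠ r in l, 0 < μ.real (B r))
    (h_nested : ∀ᶠ r in l, V r ⊆ B r ∨ B r ⊆ V r)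
    (h_ratio : Tendsto (fun r => μ.real (V r) / μ.real (B r)) l (𝓝 1)) :
    HasExtremalIndex μ T l V L := by
  obtain ⟨q, hq, hqL⟩ := h
  refine ⟨q, fun J => ?_, hqL⟩
  have h_err : Tendsto (fun r => (J + 1) * |1 - μ.real (V r) / μ.real (B r)|) l (𝓝 0) := by
    simpa using ((h_ratio.const_sub 1).abs).const_mul ((J : ℝ) + 1)
  have h_scaled : Tendsto (fun r => μ.real (V r) / μ.real (B r) * escapeRatio μ T (V r) J) l
      (𝓝 (q J)) := by
    refine (hq J).congr_dist (squeeze_zero' (Eventually.of_forall fun _ => dist_nonneg) ?_ h_err)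
    filter_upwards [hV, hB, hB0, h_nested] with r hV hB hB0 h_nested
    rw [dist_comm, Real.dist_eq]
    exact abs_escapeRatio_sub_le hμ hV hB h_nested hB0 J
  have h_div := h_scaled.div h_ratio one_ne_zero
  rw [div_one] at h_div
  refine h_div.congr' ?_
  filter_upwards [h_ratio.eventually_ne one_ne_zero] with r hr using mul_div_cancel_left₀ _ hr

end ExtremalIndex

section Balls

variable {Ω : Type*} [EMetricSpace Ω] {T : Ω → Ω} {A : ℕ → Set Ω} {z : Ω}

lemma rball_mono : Monotone (rball z) := fun _ _ h =>
  Metric.eball_subset_eball (ENNReal.ofReal_le_ofReal h)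

lemma measurableSet_rball [MeasurableSpace Ω] [OpensMeasurableSpace Ω] (r : ℝ) :
    MeasurableSet (rball z r) :=
  Metric.isOpen_eball.measurableSet

lemma innerApprox_subset (n : ℕ) (r : ℝ) : innerApprox T A z n r ⊆ rball z r :=
  sUnion_subset fun _ hC => hC.2

lemma subset_outerApprox (hA : ⋃ i, A i = univ) (n : ℕ) (r : ℝ) :
    rball z r ⊆ outerApprox T A z n r := by
  intro x hx
  obtain ⟨C, hC, hxC⟩ := exists_mem_cylinders (T := T) hA n x
  exact ⟨C, ⟨hC, x, hxC, hx⟩, hxC⟩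

lemma mem_rball_add {x y : Ω} {r δ : ℝ} (hr : 0 ≤ r) (hδ : 0 ≤ δ) (hy : y ∈ rball z r)
    (hxy : edist x y ≤ ENNReal.ofReal δ) : x ∈ rball z (r + δ) := by
  rw [rball, Metric.mem_eball, ENNReal.ofReal_add hr hδ, add_comm]
  exact (edist_triangle x y z).trans_lt
    (ENNReal.add_lt_add_of_le_of_lt (ne_top_of_le_ne_top ENNReal.ofReal_ne_top hxy) hxy hy)

lemma outerApprox_subset {n : ℕ} {r δ : ℝ} (hr : 0 ≤ r) (hδ : 0 ≤ δ)
    (hdiam : ∀ C ∈ cylinders T A n, Metric.ediam C ≤ ENNReal.ofReal δ) :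
    outerApprox T A z n r ⊆ rball z (r + δ) := by
  rintro x ⟨C, ⟨hC, y, hyC, hy⟩, hxC⟩
  exact mem_rball_add hr hδ hy ((Metric.edist_le_ediam_of_mem hxC hyC).trans (hdiam C hC))

lemma subset_innerApprox (hA : ⋃ i, A i = univ) {n : ℕ} {r δ : ℝ} (hδ : 0 ≤ δ)
    (hdiam : ∀ C ∈ cylinders T A n, Metric.ediam C ≤ ENNReal.ofReal δ) :
    rball z (r - δ) ⊆ innerApprox T A z n r := by
  intro x hx
  have hr : 0 < r - δ := ENNReal.ofReal_pos.1 (bot_le.trans_lt (Metric.mem_eball.1 hx))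
  obtain ⟨C, hC, hxC⟩ := exists_mem_cylinders (T := T) hA n x
  refine ⟨C, ⟨hC, fun y hy => ?_⟩, hxC⟩
  simpa only [sub_add_cancel] using
    mem_rball_add hr.le hδ hx ((Metric.edist_le_ediam_of_mem hy hxC).trans (hdiam C hC))

lemma measurableSet_innerApprox (n : ℕ) (r : ℝ) :
    MeasurableSet[cylinderAlgebra T A n] (innerApprox T A z n r) :=
  @MeasurableSet.sUnion _ (cylinderAlgebra T A n) _
    ((countable_cylinders n).mono fun _ hC => hC.1)
    fun _ hC => MeasurableSpace.measurableSet_generateFrom hC.1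

lemma measurableSet_outerApprox (n : ℕ) (r : ℝ) :
    MeasurableSet[cylinderAlgebra T A n] (outerApprox T A z n r) :=
  @MeasurableSet.sUnion _ (cylinderAlgebra T A n) _
    ((countable_cylinders n).mono fun _ hC => hC.1)
    fun _ hC => MeasurableSpace.measurableSet_generateFrom hC.1

lemma eventually_rball_subset {V : Set Ω} (hV : V ∈ 𝓝 z) :
    ∀ᶠ r in 𝓝[>] (0 : ℝ), rball z r ⊆ V := by
  obtain ⟨ε, hε, hεV⟩ := EMetric.mem_nhds_iff.1 hV
  have h_radius : Tendsto ENNReal.ofReal (𝓝[>] 0) (𝓝 0) := by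
    simpa using (ENNReal.continuous_ofReal.tendsto 0).mono_left nhdsWithin_le_nhds
  filter_upwards [h_radius.eventually_lt_const hε] with r hr
  exact (Metric.eball_subset_eball hr.le).trans hεV

lemma eventually_disjoint_rball (hT : Continuous T) {j : ℕ} (hj : T^[j] z ≠ z) :
    ∀ᶠ r in 𝓝[>] (0 : ℝ), Disjoint (rball z r) (T^[j] ⁻¹' rball z r) := by
  obtain ⟨u, w, hu, hw, hzu, hzw, huw⟩ := t2_separation hj
  have hV : T^[j] ⁻¹' u ∩ w ∈ 𝓝 z :=
    inter_mem ((hT.iterate j).continuousAt.preimage_mem_nhds (hu.mem_nhds hzu)) (hw.mem_nhds hzw)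
  filter_upwards [eventually_rball_subset hV] with r hr
  exact disjoint_left.2 fun x hx hx' => disjoint_left.1 huw (hr hx).1 (hr hx').2

lemma eventually_rball_subset_avoid (hT : Continuous T) {J : ℕ}
    (hJ : ∀ j, 1 ≤ j → j ≤ J → T^[j] z ≠ z) :
    ∀ᶠ r in 𝓝[>] (0 : ℝ), rball z r ⊆ avoid T (rball z r) J := by
  have h_disj : ∀ᶠ r in 𝓝[>] (0 : ℝ), ∀ j ∈ Finset.Icc 1 J,
      Disjoint (rball z r) (T^[j] ⁻¹' rball z r) :=
    (Filter.eventually_all_finset _).2 fun j hj =>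
      eventually_disjoint_rball hT (hJ j (Finset.mem_Icc.1 hj).1 (Finset.mem_Icc.1 hj).2)
  filter_upwards [h_disj] with r hr x hx j h1 h2
  exact disjoint_left.1 (hr j (Finset.mem_Icc.2 ⟨h1, h2⟩)) hx

end Balls

section Annulus

variable {F : ℝ → ℝ} {v : ℝ}

lemma tendsto_rpow_nhdsGT_zero {a : ℝ} (ha : 0 < a) :
    Tendsto (fun r : ℝ => r ^ a) (𝓝[>] 0) (𝓝 0) := by
  have h_cont := (Real.continuousAt_rpow_const 0 a (Or.inr ha.le)).tendsto
  rw [Real.zero_rpow ha.ne'] at h_cont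
  exact h_cont.mono_left nhdsWithin_le_nhds

lemma tendsto_add_mul_rpow (hv : 0 < v) (C : ℝ) :
    Tendsto (fun r : ℝ => r + C * r ^ v) (𝓝[>] 0) (𝓝 0) := by
  have h_id : Tendsto (fun r : ℝ => r) (𝓝[>] 0) (𝓝 0) := nhdsWithin_le_nhds
  simpa using h_id.add ((tendsto_rpow_nhdsGT_zero hv).const_mul C)

lemma eventually_mul_rpow_le_half (hv : 1 < v) (C : ℝ) :
    ∀ᶠ r in 𝓝[>] (0 : ℝ), C * r ^ v ≤ r / 2 := by
  have h_zero := (tendsto_rpow_nhdsGT_zero (sub_pos.2 hv)).const_mul C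
  rw [mul_zero] at h_zero
  filter_upwards [h_zero.eventually_lt_const (show (0 : ℝ) < 1 / 2 by norm_num),
    self_mem_nhdsWithin] with r hr (hr0 : 0 < r)
  rw [Real.rpow_sub_one hr0.ne', ← mul_div_assoc, div_lt_iff₀ hr0] at hr
  linarith

lemma eventually_pos_of_tendsto_div (hF0 : ∀ r, 0 ≤ F r) {G : ℝ → ℝ}
    (h : Tendsto (fun r => G r / F r) (𝓝[>] 0) (𝓝 1)) : ∀ᶠ r in 𝓝[>] 0, 0 < F r := by
  filter_upwards [h.eventually_const_lt one_pos] with r hr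
  refine (hF0 r).lt_of_ne fun h0 => ?_
  rw [← h0, div_zero] at hr
  exact lt_irrefl _ hr

lemma tendsto_annulus_nat (hF : Monotone F) (hF0 : ∀ r, 0 ≤ F r) (hv : 0 < v)
    (h : Tendsto (fun r => F (r + r ^ v) / F r) (𝓝[>] 0) (𝓝 1)) (K : ℕ) :
    Tendsto (fun r => F (r + K * r ^ v) / F r) (𝓝[>] 0) (𝓝 1) := by
  have h_pos := eventually_pos_of_tendsto_div hF0 h
  induction K with
  | zero =>
    refine tendsto_const_nhds.congr' ?_
    filter_upwards [h_pos] with r hr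
    simp [hr.ne']
  | succ K ih =>
    have h_radius : Tendsto (fun r : ℝ => r + K * r ^ v) (𝓝[>] 0) (𝓝[>] 0) := by
      refine tendsto_nhdsWithin_iff.2 ⟨tendsto_add_mul_rpow hv K, ?_⟩
      filter_upwards [self_mem_nhdsWithin] with r (hr : 0 < r)
      exact mem_Ioi.2 (by positivity)
    have h_mul := (h.comp h_radius).mul ih
    rw [one_mul] at h_mul
    refine tendsto_of_tendsto_of_tendsto_of_le_of_le' tendsto_const_nhds h_mul ?_ ?_
    · filter_upwards [h_pos, self_mem_nhdsWithin] with r hr (hr0 : 0 < r)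
      rw [one_le_div hr]
      exact hF (le_add_of_nonneg_right (by positivity))
    · filter_upwards [h_pos, self_mem_nhdsWithin] with r hr (hr0 : 0 < r)
      have hK : (0 : ℝ) ≤ K * r ^ v := by positivity
      have h_pow : r ^ v ≤ (r + K * r ^ v) ^ v := by gcongr; linarith
      rw [Function.comp_apply, div_mul_div_cancel₀ (hr.trans_le (hF (by linarith))).ne']
      gcongr
      refine hF ?_
      push_cast
      linarith

lemma tendsto_annulus (hF : Monotone F) (hF0 : ∀ r, 0 ≤ F r) (hv : 0 < v)
    (h : Tendsto (fun r => F (r + r ^ v) / F r) (𝓝[>] 0) (𝓝 1)) {C : ℝ} (hC : 0 ≤ C) :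
    Tendsto (fun r => F (r + C * r ^ v) / F r) (𝓝[>] 0) (𝓝 1) := by
  have h_pos := eventually_pos_of_tendsto_div hF0 h
  refine tendsto_of_tendsto_of_tendsto_of_le_of_le' tendsto_const_nhds
    (tendsto_annulus_nat hF hF0 hv h ⌈C⌉₊) ?_ ?_
  · filter_upwards [h_pos, self_mem_nhdsWithin] with r hr (hr0 : 0 < r)
    rw [one_le_div hr]
    exact hF (le_add_of_nonneg_right (by positivity))
  · filter_upwards [h_pos, self_mem_nhdsWithin] with r hr (hr0 : 0 < r)
    gcongr
    refine hF ?_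
    gcongr
    exact Nat.le_ceil C

/- With `ρ = r - C r ^ v ≥ r / 2` the radius `r` is at most `ρ + C 2 ^ v ρ ^ v`, so the claim is
about the outer annuli at `ρ`. -/
lemma tendsto_inner_annulus (hF : Monotone F) (hF0 : ∀ r, 0 ≤ F r) (hv : 1 < v)
    (h : Tendsto (fun r => F (r + r ^ v) / F r) (𝓝[>] 0) (𝓝 1)) {C : ℝ} (hC : 0 ≤ C) :
    Tendsto (fun r => F (r - C * r ^ v) / F r) (𝓝[>] 0) (𝓝 1) := by
  have hv0 : 0 < v := by linarith
  have h_pos := eventually_pos_of_tendsto_div hF0 h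
  have h_half := eventually_mul_rpow_le_half hv C
  have h_radius : Tendsto (fun r : ℝ => r - C * r ^ v) (𝓝[>] 0) (𝓝[>] 0) := by
    refine tendsto_nhdsWithin_iff.2
      ⟨by simpa [sub_eq_add_neg] using tendsto_add_mul_rpow hv0 (-C), ?_⟩
    filter_upwards [h_half, self_mem_nhdsWithin] with r hr (hr0 : 0 < r)
    exact mem_Ioi.2 (by linarith)
  have hC' : 0 ≤ C * 2 ^ v := by positivity
  have h_inv := ((tendsto_annulus hF hF0 hv0 h hC').comp h_radius).inv₀ one_ne_zero
  rw [inv_one] at h_inv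
  refine tendsto_of_tendsto_of_tendsto_of_le_of_le' h_inv tendsto_const_nhds ?_ ?_
  · filter_upwards [h_half, h_pos, self_mem_nhdsWithin] with r h_half hr (hr0 : 0 < r)
    rw [Function.comp_apply, inv_div]
    refine div_le_div_of_nonneg_left (hF0 _) hr (hF ?_)
    have h_pow : r ^ v ≤ (2 * (r - C * r ^ v)) ^ v := by gcongr; linarith
    rw [Real.mul_rpow zero_le_two (by linarith)] at h_pow
    linarith [mul_le_mul_of_nonneg_left h_pow hC]
  · filter_upwards [h_pos, self_mem_nhdsWithin] with r hr (hr0 : 0 < r)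
    rw [div_le_one hr]
    exact hF (sub_le_self _ (by positivity))

end Annulus

section BallMixing

variable {Ω : Type*} [EMetricSpace Ω] {T : Ω → Ω} {A : ℕ → Set Ω} {κ v : ℝ} {z : Ω}

/-- The order of the cylinders that resolve the ball of radius `r` to the scale `r ^ v`, if their
diameters are of order `n ^ (-κ)`. -/
def order (κ v r : ℝ) : ℕ := ⌈r ^ (-v / κ)⌉₊

lemma order_spec (hκ : 0 < κ) {r : ℝ} (hr : 0 < r) :
    1 ≤ order κ v r ∧ (order κ v r : ℝ) ^ (-κ) ≤ r ^ v := by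
  have h_pos : 0 < r ^ (-v / κ) := by positivity
  refine ⟨Nat.one_le_iff_ne_zero.2 (Nat.ceil_pos.2 h_pos).ne', ?_⟩
  calc (order κ v r : ℝ) ^ (-κ) ≤ (r ^ (-v / κ)) ^ (-κ) :=
        Real.rpow_le_rpow_of_nonpos h_pos (Nat.le_ceil _) (neg_nonpos.2 hκ.le)
    _ = r ^ v := by
        rw [← Real.rpow_mul hr.le]
        congr 1
        field_simp

lemma tendsto_order_mul_rpow {d : ℝ} (hκ : 0 < κ) (hd : 0 < d) (hv : v < κ * d) :
    Tendsto (fun r : ℝ => order κ v r * r ^ d) (𝓝[>] 0) (𝓝 0) := by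
  have h_exp : 0 < d + -v / κ := by
    rw [neg_div, ← sub_eq_add_neg, sub_pos, div_lt_iff₀ hκ]
    linarith
  have h_zero := (tendsto_rpow_nhdsGT_zero h_exp).add (tendsto_rpow_nhdsGT_zero hd)
  rw [add_zero] at h_zero
  refine squeeze_zero' ?_ ?_ h_zero
  · filter_upwards [self_mem_nhdsWithin] with r (hr : 0 < r)
    positivity
  · filter_upwards [self_mem_nhdsWithin] with r (hr : 0 < r)
    rw [Real.rpow_add hr, mul_comm (r ^ d), ← add_one_mul]
    gcongr
    exact (Nat.ceil_lt_add_one (by positivity)).le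

/-- The standing assumptions on the dynamical system and on the balls around the point `z`. -/
structure BallMixing [MeasurableSpace Ω] (μ : Measure Ω) (T : Ω → Ω) (A : ℕ → Set Ω) (φ : ℕ → ℝ)
    (κ c v d : ℝ) (z : Ω) : Prop where
  preserving : MeasurePreserving T μ μ
  partition : IsMeasurablePartition A
  mixing : IsRightPhiMixing μ T A φ
  c_nonneg : 0 ≤ c
  one_lt_v : 1 < v
  d_pos : 0 < d
  v_lt : v < κ * d
  diam : ∀ n : ℕ, 1 ≤ n → ∀ C ∈ cylinders T A n,
    Metric.ediam C ≤ ENNReal.ofReal (c * (n : ℝ) ^ (-κ))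
  annulus : Tendsto (fun r : ℝ => μ.real (rball z (r + r ^ v)) / μ.real (rball z r))
    (𝓝[>] 0) (𝓝 1)
  ball : (fun r : ℝ => μ.real (rball z r)) =O[𝓝[>] 0] fun r : ℝ => r ^ d

variable [MeasurableSpace Ω] {μ : Measure Ω}

/-- A family `U r` of unions of cylinders of order `order κ v r` that approximates the balls
`B_r(z)` from inside or from outside, up to a part of negligible relative measure. -/
structure IsBallApprox (μ : Measure Ω) (T : Ω → Ω) (A : ℕ → Set Ω) (κ v : ℝ) (z : Ω)
    (U : ℝ → Set Ω) : Prop where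
  measurableSet : ∀ r, MeasurableSet[cylinderAlgebra T A (order κ v r)] (U r)
  subset_two_mul : ∀ᶠ r in 𝓝[>] 0, U r ⊆ rball z (2 * r)
  nested : ∀ r, U r ⊆ rball z r ∨ rball z r ⊆ U r
  tendsto_div : Tendsto (fun r => μ.real (U r) / μ.real (rball z r)) (𝓝[>] 0) (𝓝 1)

variable {φ : ℕ → ℝ} {c d : ℝ}

lemma monotone_measureReal_rball [IsFiniteMeasure μ] : Monotone fun r => μ.real (rball z r) :=
  fun _ _ h => measureReal_mono (rball_mono h)

namespace BallMixing

variable (h : BallMixing μ T A φ κ c v d z)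
include h

lemma κ_pos : 0 < κ :=
  pos_of_mul_pos_left ((zero_lt_one.trans h.one_lt_v).trans h.v_lt) h.d_pos.le

lemma eventually_measureReal_rball_pos : ∀ᶠ r in 𝓝[>] (0 : ℝ), 0 < μ.real (rball z r) :=
  eventually_pos_of_tendsto_div (F := fun r => μ.real (rball z r)) (fun _ => measureReal_nonneg)
    h.annulus

lemma tendsto_measureReal_rball : Tendsto (fun r => μ.real (rball z r)) (𝓝[>] 0) (𝓝[>] 0) :=
  tendsto_nhdsWithin_iff.2 ⟨h.ball.trans_tendsto (tendsto_rpow_nhdsGT_zero h.d_pos),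
    h.eventually_measureReal_rball_pos⟩

lemma measurableSet_of_cylinderAlgebra {n : ℕ} {U : Set Ω}
    (hU : MeasurableSet[cylinderAlgebra T A n] U) : MeasurableSet U :=
  cylinderAlgebra_le_measurable h.preserving.measurable h.partition.measurableSet _ _ hU

lemma outerApprox_subset_rball {n : ℕ} {r : ℝ} (hr : 0 < r)
    (hn : 1 ≤ n ∧ (n : ℝ) ^ (-κ) ≤ r ^ v) :
    outerApprox T A z n r ⊆ rball z (r + c * r ^ v) := by
  have hc := h.c_nonneg
  refine (outerApprox_subset hr.le (by positivity) (h.diam _ hn.1)).trans (rball_mono ?_)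
  gcongr
  exact hn.2

lemma rball_subset_innerApprox {n : ℕ} {r : ℝ} (hn : 1 ≤ n ∧ (n : ℝ) ^ (-κ) ≤ r ^ v) :
    rball z (r - c * r ^ v) ⊆ innerApprox T A z n r := by
  have hc := h.c_nonneg
  refine (rball_mono ?_).trans
    (subset_innerApprox h.partition.iUnion_eq (by positivity) (h.diam _ hn.1))
  gcongr
  exact hn.2

variable [IsProbabilityMeasure μ]

lemma tendsto_innerApprox_div {N : ℝ → ℕ}
    (hN : ∀ r : ℝ, 0 < r → 1 ≤ N r ∧ (N r : ℝ) ^ (-κ) ≤ r ^ v) :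
    Tendsto (fun r => μ.real (innerApprox T A z (N r) r) / μ.real (rball z r)) (𝓝[>] 0)
      (𝓝 1) := by
  refine tendsto_of_tendsto_of_tendsto_of_le_of_le'
    (tendsto_inner_annulus monotone_measureReal_rball (fun _ => measureReal_nonneg) h.one_lt_v
      h.annulus h.c_nonneg) tendsto_const_nhds ?_ ?_
  · filter_upwards [self_mem_nhdsWithin] with r hr
    exact div_le_div_of_nonneg_right (measureReal_mono (h.rball_subset_innerApprox (hN r hr)))
      measureReal_nonneg
  · exact Eventually.of_forall fun r =>
      div_le_one_of_le₀ (measureReal_mono (innerApprox_subset _ _)) measureReal_nonneg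

lemma tendsto_outerApprox_div {N : ℝ → ℕ}
    (hN : ∀ r : ℝ, 0 < r → 1 ≤ N r ∧ (N r : ℝ) ^ (-κ) ≤ r ^ v) :
    Tendsto (fun r => μ.real (outerApprox T A z (N r) r) / μ.real (rball z r)) (𝓝[>] 0)
      (𝓝 1) := by
  refine tendsto_of_tendsto_of_tendsto_of_le_of_le' tendsto_const_nhds
    (tendsto_annulus monotone_measureReal_rball (fun _ => measureReal_nonneg)
      (zero_lt_one.trans h.one_lt_v) h.annulus h.c_nonneg) ?_ ?_
  · filter_upwards [h.eventually_measureReal_rball_pos] with r hr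
    rw [one_le_div hr]
    exact measureReal_mono (subset_outerApprox h.partition.iUnion_eq _ _)
  · filter_upwards [self_mem_nhdsWithin] with r hr
    exact div_le_div_of_nonneg_right (measureReal_mono (h.outerApprox_subset_rball hr (hN r hr)))
      measureReal_nonneg

lemma isBallApprox_innerApprox :
    IsBallApprox μ T A κ v z fun r => innerApprox T A z (order κ v r) r where
  measurableSet _ := measurableSet_innerApprox _ _
  subset_two_mul := by
    filter_upwards [self_mem_nhdsWithin] with r (hr : 0 < r)
    exact (innerApprox_subset _ _).trans (rball_mono (by linarith))
  nested _ := Or.inl (innerApprox_subset _ _)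
  tendsto_div := h.tendsto_innerApprox_div fun _ => order_spec h.κ_pos

lemma isBallApprox_outerApprox :
    IsBallApprox μ T A κ v z fun r => outerApprox T A z (order κ v r) r where
  measurableSet _ := measurableSet_outerApprox _ _
  subset_two_mul := by
    filter_upwards [eventually_mul_rpow_le_half h.one_lt_v c, self_mem_nhdsWithin]
      with r h_half (hr : 0 < r)
    exact (h.outerApprox_subset_rball hr (order_spec h.κ_pos hr)).trans (rball_mono (by linarith))
  nested _ := Or.inr (subset_outerApprox h.partition.iUnion_eq _ _)
  tendsto_div := h.tendsto_outerApprox_div fun _ => order_spec h.κ_pos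

lemma exists_measureReal_rball_le :
    ∃ C : ℝ, 0 ≤ C ∧ ∀ r, 0 < r → μ.real (rball z r) ≤ C * r ^ d := by
  obtain ⟨C, hC, h_near⟩ := h.ball.exists_pos
  rw [Asymptotics.isBigOWith_iff, eventually_nhdsWithin_iff, Metric.eventually_nhds_iff] at h_near
  obtain ⟨ρ, hρ, h_near⟩ := h_near
  have hρd : 0 < ρ ^ d := by positivity
  refine ⟨max C (ρ ^ d)⁻¹, by positivity, fun r hr => ?_⟩
  have hrd : 0 < r ^ d := by positivity
  obtain hlt | hge := lt_or_ge r ρ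
  · have h_le := h_near (y := r) (by rwa [Real.dist_eq, sub_zero, abs_of_pos hr]) hr
    rw [Real.norm_of_nonneg measureReal_nonneg, Real.norm_of_nonneg hrd.le] at h_le
    exact h_le.trans (by gcongr; exact le_max_left _ _)
  · calc μ.real (rball z r) ≤ 1 := measureReal_le_one
      _ ≤ (ρ ^ d)⁻¹ * r ^ d := by
          rw [inv_mul_eq_div, one_le_div hρd]
          exact Real.rpow_le_rpow hρ.le hge h.d_pos.le
      _ ≤ max C (ρ ^ d)⁻¹ * r ^ d := by gcongr; exact le_max_right _ _

end BallMixing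

lemma add_mul_rpow_le {a b c d : ℝ} (ha : 0 ≤ a) (hb : 0 ≤ b) (hc : 0 ≤ c) (hd : 0 ≤ d) :
    (a + c * b) ^ d ≤ (1 + c) ^ d * (a ^ d + b ^ d) := by
  have h_max : a + c * b ≤ (1 + c) * max a b := by
    linarith [le_max_left a b, mul_le_mul_of_nonneg_left (le_max_right a b) hc]
  have h_pow : max a b ^ d ≤ a ^ d + b ^ d := by
    obtain hab | hba := le_total a b
    · rw [max_eq_right hab]
      exact le_add_of_nonneg_left (by positivity)
    · rw [max_eq_left hba]
      exact le_add_of_nonneg_right (by positivity)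
  calc (a + c * b) ^ d ≤ ((1 + c) * max a b) ^ d := by gcongr
    _ = (1 + c) ^ d * max a b ^ d := Real.mul_rpow (by positivity) (by positivity)
    _ ≤ (1 + c) ^ d * (a ^ d + b ^ d) := by gcongr

lemma BallMixing.exists_measureReal_outerApprox_le [IsProbabilityMeasure μ]
    (h : BallMixing μ T A φ κ c v d z) :
    ∃ C : ℝ, 0 ≤ C ∧ ∀ r, 0 < r → ∀ n : ℕ, 1 ≤ n →
      μ.real (outerApprox T A z n r) ≤ C * (r ^ d + (n : ℝ) ^ (-(κ * d))) := by
  obtain ⟨C, hC, h_ball⟩ := h.exists_measureReal_rball_le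
  have hc := h.c_nonneg
  refine ⟨C * (1 + c) ^ d, by positivity, fun r hr n hn => ?_⟩
  calc μ.real (outerApprox T A z n r) ≤ μ.real (rball z (r + c * (n : ℝ) ^ (-κ))) :=
        measureReal_mono (outerApprox_subset hr.le (by positivity) (h.diam n hn))
    _ ≤ C * (r + c * (n : ℝ) ^ (-κ)) ^ d := h_ball _ (by positivity)
    _ ≤ C * ((1 + c) ^ d * (r ^ d + ((n : ℝ) ^ (-κ)) ^ d)) := by
        gcongr
        exact add_mul_rpow_le hr.le (by positivity) hc h.d_pos.le
    _ = C * (1 + c) ^ d * (r ^ d + (n : ℝ) ^ (-(κ * d))) := by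
        rw [← Real.rpow_mul n.cast_nonneg, neg_mul, mul_assoc]

end BallMixing

section FiniteClusters

lemma summable_comp_half {u : ℕ → ℝ} (hu : Summable u) : Summable fun j => u (j / 2) := by
  refine Summable.even_add_odd ?_ ?_
  · simpa only [Nat.mul_div_cancel_left _ two_pos] using hu
  · simpa only [Nat.mul_add_div two_pos, Nat.reduceDiv, add_zero] using hu

lemma eventually_sum_Ioc_lt {u : ℕ → ℝ} (hu : Summable u) {ε : ℝ} (hε : 0 < ε) :
    ∀ᶠ J in atTop, ∀ e, ∑ j ∈ Finset.Ioc J (J + e), u j < ε := by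
  obtain ⟨s, hs⟩ := summable_iff_vanishing_norm.1 hu ε hε
  filter_upwards [eventually_ge_atTop (s.sup id)] with J hJ e
  refine (le_abs_self _).trans_lt (hs _ (Finset.disjoint_right.2 fun j hj h_mem => ?_))
  exact ((Finset.le_sup (f := id) hj).trans hJ).not_gt (Finset.mem_Ioc.1 h_mem).1

variable {Ω : Type*} [EMetricSpace Ω] {T : Ω → Ω} {A : ℕ → Set Ω} {z : Ω} {U : Set Ω}

/-- A union of `m`-cylinders that contains the union `U ⊆ B_ρ(z)` of `n`-cylinders: the outer
approximation of `B_ρ(z)` if `m < n`, and `U` itself if `n ≤ m`. -/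
def coarsening (T : Ω → Ω) (A : ℕ → Set Ω) (z : Ω) (ρ : ℝ) (n : ℕ) (U : Set Ω) (m : ℕ) : Set Ω :=
  if m < n then outerApprox T A z m ρ else U

lemma measurableSet_coarsening (hA : ⋃ i, A i = univ) {n : ℕ}
    (hU : MeasurableSet[cylinderAlgebra T A n] U) (ρ : ℝ) (m : ℕ) :
    MeasurableSet[cylinderAlgebra T A m] (coarsening T A z ρ n U m) := by
  unfold coarsening
  split_ifs with hm
  · exact measurableSet_outerApprox m ρ
  · exact cylinderAlgebra_mono hA (not_lt.1 hm) _ hU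

lemma subset_coarsening (hA : ⋃ i, A i = univ) {ρ : ℝ} (hU : U ⊆ rball z ρ) (n m : ℕ) :
    U ⊆ coarsening T A z ρ n U m := by
  unfold coarsening
  split_ifs
  · exact hU.trans (subset_outerApprox hA m ρ)
  · exact Subset.rfl

variable [MeasurableSpace Ω] {μ : Measure Ω} {φ : ℕ → ℝ} {κ c v d : ℝ} {Us : ℝ → Set Ω}
  [IsProbabilityMeasure μ]

lemma BallMixing.exists_measureReal_coarsening_le (h : BallMixing μ T A φ κ c v d z) :
    ∃ C : ℝ, 0 ≤ C ∧ ∀ ρ, 0 < ρ → ∀ (n : ℕ) (U : Set Ω) (m : ℕ), 1 ≤ m →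
      μ.real (coarsening T A z ρ n U m) ≤
        (if m < n then C * ρ ^ d else 0) + C * (m : ℝ) ^ (-(κ * d)) + μ.real U := by
  obtain ⟨C, hC, h_outer⟩ := h.exists_measureReal_outerApprox_le
  refine ⟨C, hC, fun ρ hρ n U m hm => ?_⟩
  have h_tail : 0 ≤ C * (m : ℝ) ^ (-(κ * d)) := by positivity
  have hU_nonneg : 0 ≤ μ.real U := measureReal_nonneg
  unfold coarsening
  split_ifs
  · linarith [h_outer ρ hρ m hm, mul_add C (ρ ^ d) ((m : ℝ) ^ (-(κ * d)))]
  · linarith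

lemma BallMixing.exists_sum_measureReal_coarsening_le (h : BallMixing μ T A φ κ c v d z) :
    ∃ C : ℝ, ∀ ρ, 0 < ρ → ∀ (n : ℕ) (U : Set Ω) (J e : ℕ), 1 ≤ J →
      ∑ j ∈ Finset.Ioc J (J + e), μ.real (coarsening T A z ρ n U (j / 2)) ≤
        C * (n * ρ ^ d) +
          ∑ j ∈ Finset.Ioc J (J + e), C * ((j / 2 : ℕ) : ℝ) ^ (-(κ * d)) + e * μ.real U := by
  obtain ⟨C, hC, h_coarse⟩ := h.exists_measureReal_coarsening_le
  refine ⟨2 * C, fun ρ hρ n U J e hJ => ?_⟩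
  have h_scale : ∑ j ∈ Finset.Ioc J (J + e), (if j / 2 < n then C * ρ ^ d else 0) ≤
      2 * C * (n * ρ ^ d) := by
    simp only [Nat.div_lt_iff_lt_mul two_pos]
    refine (sum_ite_lt_le (by positivity) _ _).trans_eq ?_
    push_cast
    ring
  calc ∑ j ∈ Finset.Ioc J (J + e), μ.real (coarsening T A z ρ n U (j / 2)) ≤
        ∑ j ∈ Finset.Ioc J (J + e), ((if j / 2 < n then C * ρ ^ d else 0) +
          C * ((j / 2 : ℕ) : ℝ) ^ (-(κ * d)) + μ.real U) :=
        Finset.sum_le_sum fun j hj =>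
          h_coarse ρ hρ n U _ (by have := Finset.mem_Ioc.1 hj; omega)
    _ = ∑ j ∈ Finset.Ioc J (J + e), (if j / 2 < n then C * ρ ^ d else 0) +
          ∑ j ∈ Finset.Ioc J (J + e), C * ((j / 2 : ℕ) : ℝ) ^ (-(κ * d)) + e * μ.real U := by
        rw [Finset.sum_add_distrib, Finset.sum_add_distrib, Finset.sum_const, Nat.card_Ioc,
          add_tsub_cancel_left, nsmul_eq_mul]
    _ ≤ _ := by
        gcongr with j
        linarith

lemma escapeRatio_sub_le (hμ : MeasurePreserving T μ μ) (hA : IsMeasurablePartition A)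
    (hmix : IsRightPhiMixing μ T A φ) {n : ℕ} {ρ : ℝ}
    (hU : MeasurableSet[cylinderAlgebra T A n] U) (hUρ : U ⊆ rball z ρ) (J e : ℕ) :
    escapeRatio μ T U J - escapeRatio μ T U (J + e) ≤
      ∑ j ∈ Finset.Ioc J (J + e), μ.real (coarsening T A z ρ n U (j / 2)) + φ (J / 2) := by
  have hφ := hmix.nonneg (J / 2)
  rw [escapeRatio, escapeRatio, ← sub_div]
  refine div_le_of_le_mul₀ measureReal_nonneg ?_ (measureReal_inter_avoid_sub_le hμ hA hmix hU
    (fun j => measurableSet_coarsening hA.iUnion_eq hU ρ (j / 2))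
    (fun j => subset_coarsening hA.iUnion_eq hUρ n (j / 2)) J e)
  exact add_nonneg (Finset.sum_nonneg fun _ _ => measureReal_nonneg) hφ

lemma IsBallApprox.hasFiniteClusters (hUs : IsBallApprox μ T A κ v z Us)
    (h : BallMixing μ T A φ κ c v d z) : HasFiniteClusters μ T (𝓝[>] 0) Us := by
  intro δ hδ
  obtain ⟨C, h_sum⟩ := h.exists_sum_measureReal_coarsening_le
  have h_summable := (Real.summable_nat_rpow (p := -(κ * d))).2 (by linarith [h.one_lt_v, h.v_lt])
  have h_tail := eventually_sum_Ioc_lt (summable_comp_half (h_summable.mul_left C))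
    (show 0 < δ / 3 by positivity)
  have h_mix := (h.mixing.tendsto_zero.comp (Nat.tendsto_div_const_atTop two_ne_zero)
    ).eventually_lt_const (show 0 < δ / 3 by positivity)
  have h_scale : Tendsto (fun r => C * (order κ v r * (2 * r) ^ d)) (𝓝[>] 0) (𝓝 0) := by
    have h_zero := (tendsto_order_mul_rpow h.κ_pos h.d_pos h.v_lt).const_mul (C * 2 ^ d)
    rw [mul_zero] at h_zero
    refine h_zero.congr' ?_
    filter_upwards [self_mem_nhdsWithin] with r (hr : 0 < r)
    rw [Real.mul_rpow two_pos.le hr.le]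
    ring
  filter_upwards [h_tail, h_mix, eventually_ge_atTop 1] with J h_tail h_mix hJ
  filter_upwards [h_scale.eventually_lt_const (show 0 < δ / 3 by positivity),
    hUs.subset_two_mul, self_mem_nhdsWithin] with r h_scale h_sub (hr : 0 < r) e
  have h_escape := escapeRatio_sub_le h.preserving h.partition h.mixing (hUs.measurableSet r)
    h_sub J e
  rw [Function.comp_apply] at h_mix
  linarith [h_sum (2 * r) (by positivity) (order κ v r) (Us r) J e hJ, h_tail e]

end FiniteClusters

section ExpRateOfBalls

variable {Ω : Type*} [EMetricSpace Ω] [MeasurableSpace Ω] {μ : Measure Ω} {T : Ω → Ω}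
  {A : ℕ → Set Ω} {φ : ℕ → ℝ} {κ c v d L : ℝ} {z : Ω} {U : ℝ → Set Ω}

lemma IsBallApprox.isBigO (hU : IsBallApprox μ T A κ v z U) (h : BallMixing μ T A φ κ c v d z) :
    (fun r => μ.real (U r)) =O[𝓝[>] 0] fun r : ℝ => r ^ d := by
  refine (Asymptotics.isBigO_of_div_tendsto_nhds ?_ 1 hU.tendsto_div).trans h.ball
  filter_upwards [h.eventually_measureReal_rball_pos] with r hr h0
  exact absurd h0 hr.ne'

lemma IsBallApprox.eventually_measureReal_pos (hU : IsBallApprox μ T A κ v z U)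
    (h : BallMixing μ T A φ κ c v d z) : ∀ᶠ r in 𝓝[>] 0, 0 < μ.real (U r) := by
  filter_upwards [h.eventually_measureReal_rball_pos, hU.tendsto_div.eventually_const_lt one_pos]
    with r hr h_div
  exact (div_pos_iff_of_pos_right hr).1 h_div

variable [IsProbabilityMeasure μ]

lemma IsBallApprox.hasExpRate [OpensMeasurableSpace Ω] (hU : IsBallApprox μ T A κ v z U)
    (h : BallMixing μ T A φ κ c v d z) (hL : HasExtremalIndex μ T (𝓝[>] 0) (rball z) L) :
    HasExpRate (𝓝[>] 0) (fun r t => μ.real (avoid T (U r) t)) (fun r => μ.real (U r)) L := by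
  have hU_meas (r : ℝ) : MeasurableSet (U r) :=
    h.measurableSet_of_cylinderAlgebra (hU.measurableSet r)
  have hUL : HasExtremalIndex μ T (𝓝[>] 0) U L :=
    hL.of_nested h.preserving (Eventually.of_forall hU_meas)
      (Eventually.of_forall measurableSet_rball) h.eventually_measureReal_rball_pos
      (Eventually.of_forall hU.nested) hU.tendsto_div
  have h_order : Tendsto (fun r => order κ v r * μ.real (U r)) (𝓝[>] 0) (𝓝 0) :=
    ((Asymptotics.isBigO_refl _ _).mul (hU.isBigO h)).trans_tendsto
      (tendsto_order_mul_rpow h.κ_pos h.d_pos h.v_lt)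
  exact (hUL.hasFirstOrder h.preserving (hU.hasFiniteClusters h)
    (Eventually.of_forall hU_meas)).hasExpRate
      (tendsto_nhdsWithin_iff.2 ⟨(hU.isBigO h).trans_tendsto (tendsto_rpow_nhdsGT_zero h.d_pos),
        hU.eventually_measureReal_pos h⟩)
      h_order h.mixing.tendsto_zero h.mixing.nonneg
      (Eventually.of_forall fun r =>
        isBlockSeq_avoid h.preserving h.partition h.mixing (hU.measurableSet r))

theorem BallMixing.hasExpRate [OpensMeasurableSpace Ω] (h : BallMixing μ T A φ κ c v d z)
    (hL : HasExtremalIndex μ T (𝓝[>] 0) (rball z) L) :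
    HasExpRate (𝓝[>] 0) (fun r t => μ.real (avoid T (rball z r) t)) (fun r => μ.real (rball z r))
      L := by
  have h_inner := h.isBallApprox_innerApprox
  have h_outer := h.isBallApprox_outerApprox
  refine (h_outer.hasExpRate h hL).squeeze (h_inner.hasExpRate h hL)
    h.eventually_measureReal_rball_pos (h_outer.eventually_measureReal_pos h)
    (h_inner.eventually_measureReal_pos h) h_outer.tendsto_div h_inner.tendsto_div ?_ ?_
  · exact Eventually.of_forall fun r t =>
      measureReal_mono (avoid_anti_set (subset_outerApprox h.partition.iUnion_eq _ _) t)
  · exact Eventually.of_forall fun r t =>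
      measureReal_mono (avoid_anti_set (innerApprox_subset _ _) t)

end ExpRateOfBalls

section RecurrenceLimits

lemma HasExpRate.tendsto_floor {ι : Type*} {l : Filter ι} {g : ι → ℕ → ℝ} {M x : ι → ℝ} {L : ℝ}
    (h : HasExpRate l g M L) (hx : Tendsto x l atTop) :
    Tendsto (fun r => -Real.log (g r ⌊x r⌋₊) / (x r * M r)) l (𝓝 L) := by
  have h_floor := tendsto_nat_floor_atTop.comp hx
  have h_mul := (h.comp h_floor).mul (tendsto_nat_floor_div_atTop.comp hx)
  rw [mul_one] at h_mul
  refine h_mul.congr' ?_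
  filter_upwards [h_floor.eventually_ne_atTop 0] with r hr
  simp only [Function.comp_apply] at hr ⊢
  rw [div_mul_div_comm, mul_comm _ (⌊x r⌋₊ : ℝ), mul_assoc,
    mul_div_mul_left _ _ (Nat.cast_ne_zero.2 hr), mul_comm (M r)]

variable {Ω : Type*}

lemma recurrenceRate_eq [MeasurableSpace Ω] {μ : Measure Ω} {T : Ω → Ω} {U : Set Ω} {α s : ℝ}
    (hs : 0 ≤ s) :
    recurrenceRate μ T α s U =
      -Real.log (μ.real (avoid T U ⌊s * μ.real U ^ (-α)⌋₊)) / (s * μ.real U ^ (1 - α)) := by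
  rw [recurrenceRate, survival_eq (by positivity), div_mul_eq_mul_div, neg_one_mul]

lemma tendsto_sum_floor_div {q : ℕ → ℝ} {L : ℝ} (hq : Tendsto q atTop (𝓝 L)) :
    Tendsto (fun s : ℝ => (∑ i ∈ Finset.range ⌊s⌋₊, q i) / s) atTop (𝓝 L) := by
  have h_mul := (hq.cesaro.comp tendsto_nat_floor_atTop).mul (tendsto_nat_floor_div_atTop (R := ℝ))
  rw [mul_one] at h_mul
  refine h_mul.congr' ?_
  filter_upwards [tendsto_nat_floor_atTop.eventually_ne_atTop 0] with s hs
  have h_floor : (⌊s⌋₊ : ℝ) ≠ 0 := Nat.cast_ne_zero.2 hs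
  simp only [Function.comp_apply]
  field_simp

variable [EMetricSpace Ω] [MeasurableSpace Ω] [OpensMeasurableSpace Ω] {μ : Measure Ω}
  [IsProbabilityMeasure μ] {T : Ω → Ω} {A : ℕ → Set Ω} {φ : ℕ → ℝ} {κ c v d L : ℝ} {z : Ω}

namespace BallMixing

variable (h : BallMixing μ T A φ κ c v d z) (hL : HasExtremalIndex μ T (𝓝[>] 0) (rball z) L)
include h hL

theorem hasRecurrenceLimit {α s : ℝ} (hα : 0 < α) (hs : 0 < s) :
    HasRecurrenceLimit μ T z α s L := by
  have h_time : Tendsto (fun r => s * μ.real (rball z r) ^ (-α)) (𝓝[>] 0) atTop :=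
    ((tendsto_rpow_neg_nhdsGT_zero (neg_lt_zero.2 hα)).comp
      h.tendsto_measureReal_rball).const_mul_atTop hs
  refine ((h.hasExpRate hL).tendsto_floor h_time).congr' ?_
  filter_upwards [h.eventually_measureReal_rball_pos] with r hr
  rw [recurrenceRate_eq hs.le, mul_assoc, ← Real.rpow_add_one hr.ne', neg_add_eq_sub]

theorem hasRecurrenceLimitZero : HasRecurrenceLimitZero μ T z L := by
  obtain ⟨q, hq, hqL⟩ := hL
  refine ⟨fun s => (∑ i ∈ Finset.range ⌊s⌋₊, q i) / s, fun s hs => ?_, tendsto_sum_floor_div hqL⟩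
  have h_first_order : Tendsto
      (fun r => (1 - μ.real (avoid T (rball z r) ⌊s⌋₊)) / μ.real (rball z r)) (𝓝[>] 0)
      (𝓝 (∑ i ∈ Finset.range ⌊s⌋₊, q i)) := by
    simp only [one_sub_measureReal_avoid h.preserving (measurableSet_rball _), Finset.sum_div]
    exact tendsto_finsetSum _ fun i _ => hq i
  have hM := tendsto_nhdsWithin_iff.1 h.tendsto_measureReal_rball
  refine ((tendsto_neg_log_div hM.1 (hM.2.mono fun _ hr => ne_of_gt hr) h_first_order).div_const
    s).congr fun r => ?_
  rw [recurrenceRate_eq hs.le, neg_zero, Real.rpow_zero, mul_one, sub_zero, Real.rpow_one,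
    div_div, mul_comm s]

end BallMixing

end RecurrenceLimits

section ExtremalIndexOfBalls

section NestedReturns

variable {Ω : Type*} [MeasurableSpace Ω] {μ : Measure Ω} {T : Ω → Ω} {p J : ℕ} {e : ℝ}
  {U B : Set Ω}

lemma NestedReturns.exists_abs_measureReal_inter_sub_le {N : ℝ → ℕ} {U : ℝ → Set Ω}
    (h : NestedReturns μ T p N U) (hp : 0 < p) :
    ∃ e : ℝ → ℝ, Tendsto e (𝓝[>] 0) (𝓝 0) ∧ ∀ J : ℕ, ∀ᶠ r in 𝓝[>] 0, ∀ u, 1 ≤ u → p * u ≤ J →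
      |μ.real (U r ∩ T^[p * u] ⁻¹' U r) - μ.real (iterInter T p (U r) u)| ≤
        e r * μ.real (iterInter T p (U r) u) := by
  obtain ⟨a, e, -, haN, he, h_ret⟩ := h
  refine ⟨e, he, fun J => ?_⟩
  filter_upwards [haN.eventually_ge_atTop (J : ℝ), self_mem_nhdsWithin] with r haN (hr : 0 < r)
    u hu huJ
  have h_inter : ⋂ i : Fin 2, T^[(![0, p * u] : Fin 2 → ℕ) i] ⁻¹' U r =
      U r ∩ T^[p * u] ⁻¹' U r := by
    ext x
    simp [Fin.forall_fin_two]
  have h_last : (![0, p * u] : Fin 2 → ℕ) (Fin.last 1) / p = u := Nat.mul_div_cancel_left u hp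
  have h_two := h_ret r hr 1 ![0, p * u] rfl
    (Fin.strictMono_iff_lt_succ.2 (Fin.forall_fin_one.2 (Nat.mul_pos hp hu)))
    (Fin.forall_fin_two.2 ⟨dvd_zero p, dvd_mul_right p u⟩) ((Nat.cast_le.2 huJ).trans haN)
  rwa [h_inter, h_last] at h_two

variable [IsFiniteMeasure μ]

lemma measureReal_return_sdiff_le (hμ : MeasurePreserving T μ μ) (hU : MeasurableSet U)
    (hB : MeasurableSet B) (hUB : U ⊆ B) {u : ℕ} (hu : 1 ≤ u)
    (he : |μ.real (U ∩ T^[p * u] ⁻¹' U) - μ.real (iterInter T p U u)| ≤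
      e * μ.real (iterInter T p U u)) :
    μ.real ((B ∩ T^[p * u] ⁻¹' B) \ T^[p] ⁻¹' B) ≤
      2 * (μ.real B - μ.real U) + |e| * μ.real B := by
  have h_iter_p : iterInter T p U u ⊆ T^[p] ⁻¹' B := fun x hx =>
    hUB (by simpa using mem_iInter₂.1 hx 1 (Finset.mem_range.2 (by omega)))
  have h_iter : iterInter T p U u ⊆ U ∩ T^[p * u] ⁻¹' U := fun x hx =>
    ⟨by simpa using mem_iInter₂.1 hx 0 (Finset.mem_range.2 (by omega)),
      mem_iInter₂.1 hx u (Finset.mem_range.2 (by omega))⟩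
  have h_iter_meas : MeasurableSet (iterInter T p U u) :=
    Finset.measurableSet_biInter _ fun j _ => hμ.measurable.iterate _ hU
  have h_cover : (B ∩ T^[p * u] ⁻¹' B) \ T^[p] ⁻¹' B ⊆
      ((U ∩ T^[p * u] ⁻¹' U) \ iterInter T p U u) ∪ ((B \ U) ∪ T^[p * u] ⁻¹' (B \ U)) := by
    rintro x ⟨⟨hxB, hxu⟩, hxp⟩
    by_cases hxU : x ∈ U
    · by_cases hxuU : T^[p * u] x ∈ U
      · exact Or.inl ⟨⟨hxU, hxuU⟩, fun hx => hxp (h_iter_p hx)⟩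
      · exact Or.inr (Or.inr ⟨hxu, hxuU⟩)
    · exact Or.inr (Or.inl ⟨hxB, hxU⟩)
  have h_err : e * μ.real (iterInter T p U u) ≤ |e| * μ.real B :=
    mul_le_mul (le_abs_self e) (measureReal_mono (h_iter.trans (inter_subset_left.trans hUB)))
      measureReal_nonneg (abs_nonneg e)
  have h_le := (measureReal_mono (μ := μ) h_cover).trans (measureReal_union_le _ _)
  rw [measureReal_sdiff h_iter h_iter_meas] at h_le
  have h_union := measureReal_union_le (μ := μ) (B \ U) (T^[p * u] ⁻¹' (B \ U))
  rw [measureReal_preimage_iterate hμ (hB.diff hU), measureReal_sdiff hUB hU] at h_union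
  linarith [le_of_abs_le he]

lemma measureReal_sdiff_sub_le (hμ : MeasurePreserving T μ μ) (hU : MeasurableSet U)
    (hB : MeasurableSet B) (hUB : U ⊆ B)
    (h_disj : ∀ j, 1 ≤ j → j ≤ J → ¬p ∣ j → Disjoint B (T^[j] ⁻¹' B))
    (he : ∀ u, 1 ≤ u → p * u ≤ J →
      |μ.real (U ∩ T^[p * u] ⁻¹' U) - μ.real (iterInter T p U u)| ≤
        e * μ.real (iterInter T p U u)) :
    μ.real (B \ T^[p] ⁻¹' B) - J * (2 * (μ.real B - μ.real U) + |e| * μ.real B) ≤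
      μ.real (B ∩ avoid T B J) := by
  have h_cover : B \ T^[p] ⁻¹' B ⊆
      (B ∩ avoid T B J) ∪ ⋃ j ∈ Finset.Icc 1 J, (B ∩ T^[j] ⁻¹' B) \ T^[p] ⁻¹' B := by
    rintro x ⟨hxB, hxp⟩
    refine or_iff_not_imp_left.2 fun hx => ?_
    obtain ⟨j, h1, h2, hj⟩ := notMem_avoid.1 fun h => hx ⟨hxB, h⟩
    exact mem_biUnion (Finset.mem_coe.2 (Finset.mem_Icc.2 ⟨h1, h2⟩)) ⟨⟨hxB, hj⟩, hxp⟩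
  have h_term : ∀ j ∈ Finset.Icc 1 J, μ.real ((B ∩ T^[j] ⁻¹' B) \ T^[p] ⁻¹' B) ≤
      2 * (μ.real B - μ.real U) + |e| * μ.real B := by
    intro j hj
    obtain ⟨h1, h2⟩ := Finset.mem_Icc.1 hj
    by_cases hpj : p ∣ j
    · obtain ⟨u, rfl⟩ := hpj
      have hu : 1 ≤ u := Nat.pos_of_mul_pos_left h1
      exact measureReal_return_sdiff_le hμ hU hB hUB hu (he u hu h2)
    · rw [(h_disj j h1 h2 hpj).inter_eq, empty_sdiff, measureReal_empty]
      have h_mono := sub_nonneg.2 (measureReal_mono (μ := μ) hUB)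
      positivity
  have h_sum := (measureReal_biUnion_finset_le (μ := μ) _ _).trans (Finset.sum_le_sum h_term)
  rw [Finset.sum_const, Nat.card_Icc, Nat.add_sub_cancel, nsmul_eq_mul] at h_sum
  linarith [(measureReal_mono (μ := μ) h_cover).trans (measureReal_union_le _ _)]

end NestedReturns

variable {Ω : Type*} [EMetricSpace Ω] {T : Ω → Ω} {z : Ω}

lemma eventually_disjoint_rball_of_not_dvd (hT : Continuous T) {p : ℕ}
    (hpz : Function.minimalPeriod T z = p) (J : ℕ) :
    ∀ᶠ r in 𝓝[>] (0 : ℝ), ∀ j, 1 ≤ j → j ≤ J → ¬p ∣ j →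
      Disjoint (rball z r) (T^[j] ⁻¹' rball z r) := by
  have h_each : ∀ᶠ r in 𝓝[>] (0 : ℝ), ∀ j ∈ Finset.Icc 1 J, ¬p ∣ j →
      Disjoint (rball z r) (T^[j] ⁻¹' rball z r) := by
    refine (Filter.eventually_all_finset _).2 fun j _ => Filter.eventually_imp_distrib_left.2 ?_
    exact fun hj => eventually_disjoint_rball hT fun hz =>
      hj (hpz ▸ Function.IsPeriodicPt.minimalPeriod_dvd hz)
  exact h_each.mono fun r h j h1 h2 => h j (Finset.mem_Icc.2 ⟨h1, h2⟩)

variable [MeasurableSpace Ω] {μ : Measure Ω}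
  (h_pos : ∀ᶠ r in 𝓝[>] (0 : ℝ), 0 < μ.real (rball z r))
include h_pos

lemma tendsto_escapeRatio_rball_one (hT : Continuous T) {J : ℕ}
    (hJ : ∀ j, 1 ≤ j → j ≤ J → T^[j] z ≠ z) :
    Tendsto (fun r => escapeRatio μ T (rball z r) J) (𝓝[>] 0) (𝓝 1) := by
  refine tendsto_const_nhds.congr' ?_
  filter_upwards [h_pos, eventually_rball_subset_avoid hT hJ] with r hr h_avoid
  rw [escapeRatio, inter_eq_left.2 h_avoid, div_self hr.ne']

lemma hasExtremalIndex_rball_of_notMem_periodicPts (hT : Continuous T)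
    (hz : z ∉ Function.periodicPts T) : HasExtremalIndex μ T (𝓝[>] 0) (rball z) 1 :=
  ⟨fun _ => 1, fun _ => tendsto_escapeRatio_rball_one h_pos hT
    fun j hj _ hjz => hz ⟨j, hj, hjz⟩, tendsto_const_nhds⟩

variable [OpensMeasurableSpace Ω] [IsFiniteMeasure μ] {p : ℕ} {N : ℝ → ℕ} {U : ℝ → Set Ω} {θ : ℝ}

lemma tendsto_measureReal_rball_sdiff_div (hμ : MeasurePreserving T μ μ)
    (hθ : Tendsto (fun r : ℝ => μ.real (rball z r ∩ T^[p] ⁻¹' rball z r) / μ.real (rball z r))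
      (𝓝[>] 0) (𝓝 θ)) :
    Tendsto (fun r : ℝ => μ.real (rball z r \ T^[p] ⁻¹' rball z r) / μ.real (rball z r))
      (𝓝[>] 0) (𝓝 (1 - θ)) := by
  refine (hθ.const_sub 1).congr' ?_
  filter_upwards [h_pos] with r hr
  rw [one_sub_div hr.ne', ← measureReal_inter_add_sdiff (μ := μ) (s := rball z r)
    (hμ.measurable.iterate p (measurableSet_rball r)), add_sub_cancel_left]

lemma tendsto_escapeRatio_rball_of_nestedReturns (hμ : MeasurePreserving T μ μ)
    (hT : Continuous T) (hp : 0 < p) (hpz : Function.minimalPeriod T z = p)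
    (hU : ∀ r, MeasurableSet (U r)) (hUB : ∀ r, U r ⊆ rball z r)
    (h_ratio : Tendsto (fun r => μ.real (U r) / μ.real (rball z r)) (𝓝[>] 0) (𝓝 1))
    (h_nested : NestedReturns μ T p N U)
    (hθ : Tendsto (fun r : ℝ => μ.real (rball z r ∩ T^[p] ⁻¹' rball z r) / μ.real (rball z r))
      (𝓝[>] 0) (𝓝 θ)) {J : ℕ} (hJ : p ≤ J) :
    Tendsto (fun r => escapeRatio μ T (rball z r) J) (𝓝[>] 0) (𝓝 (1 - θ)) := by
  obtain ⟨e, he, h_ret⟩ := h_nested.exists_abs_measureReal_inter_sub_le hp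
  have h_exit := tendsto_measureReal_rball_sdiff_div h_pos hμ hθ
  have h_lower : Tendsto (fun r => μ.real (rball z r \ T^[p] ⁻¹' rball z r) / μ.real (rball z r) -
      J * (2 * (1 - μ.real (U r) / μ.real (rball z r)) + |e r|)) (𝓝[>] 0) (𝓝 (1 - θ)) := by
    simpa using h_exit.sub ((((h_ratio.const_sub 1).const_mul 2).add he.abs).const_mul (J : ℝ))
  refine tendsto_of_tendsto_of_tendsto_of_le_of_le' h_lower h_exit ?_ ?_
  · filter_upwards [h_pos, eventually_disjoint_rball_of_not_dvd hT hpz J, h_ret J]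
      with r hr h_disj h_ret
    rw [escapeRatio, le_div_iff₀ hr]
    refine le_trans (le_of_eq ?_)
      (measureReal_sdiff_sub_le hμ (hU r) (measurableSet_rball r) (hUB r) h_disj h_ret)
    field_simp
  · exact Eventually.of_forall fun r => div_le_div_of_nonneg_right
      (measureReal_mono fun _ hx => ⟨hx.1, hx.2 p hp hJ⟩) measureReal_nonneg

lemma hasExtremalIndex_rball_of_nestedReturns (hμ : MeasurePreserving T μ μ)
    (hT : Continuous T) (hp : 0 < p) (hpz : Function.minimalPeriod T z = p)
    (hU : ∀ r, MeasurableSet (U r)) (hUB : ∀ r, U r ⊆ rball z r)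
    (h_ratio : Tendsto (fun r => μ.real (U r) / μ.real (rball z r)) (𝓝[>] 0) (𝓝 1))
    (h_nested : NestedReturns μ T p N U)
    (hθ : Tendsto (fun r : ℝ => μ.real (rball z r ∩ T^[p] ⁻¹' rball z r) / μ.real (rball z r))
      (𝓝[>] 0) (𝓝 θ)) :
    HasExtremalIndex μ T (𝓝[>] 0) (rball z) (1 - θ) := by
  refine ⟨fun J => if J < p then 1 else 1 - θ, fun J => ?_, ?_⟩
  · dsimp only
    split_ifs with hJ
    · refine tendsto_escapeRatio_rball_one h_pos hT fun j hj hjJ hjz => ?_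
      exact ((Function.IsPeriodicPt.minimalPeriod_le hj hjz).trans hjJ).not_gt (hpz ▸ hJ)
    · exact tendsto_escapeRatio_rball_of_nestedReturns h_pos hμ hT hp hpz hU hUB h_ratio h_nested hθ
        (not_lt.1 hJ)
  · refine tendsto_const_nhds.congr' ?_
    filter_upwards [eventually_ge_atTop p] with J hJ
    rw [if_neg hJ.not_gt]

end ExtremalIndexOfBalls

end HittingStats

end

theorem mainTheorem3_general {Ω : Type*} [EMetricSpace Ω] [MeasurableSpace Ω]
    [OpensMeasurableSpace Ω] (T : Ω → Ω) (hT : Continuous T)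
    (μ : Measure Ω) [IsProbabilityMeasure μ] (hμ : MeasurePreserving T μ μ)
    (A : ℕ → Set Ω) (hA : HittingStats.IsMeasurablePartition A)
    (φ : ℕ → ℝ) (hmix : HittingStats.IsRightPhiMixing μ T A φ)
    (κ' c₁ v d : ℝ) (hv : 1 < v) (hd : 0 < d) (hκ : 1 < κ' * d / v)
    (hdiam : ∀ n : ℕ, 1 ≤ n → ∀ C ∈ HittingStats.cylinders T A n,
      Metric.ediam C ≤ ENNReal.ofReal (c₁ * (n : ℝ) ^ (-κ')))
    (z : Ω)
    (hannulus : Tendsto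
      (fun r : ℝ => μ.real (HittingStats.rball z (r + r ^ v)) / μ.real (HittingStats.rball z r))
      (𝓝[>] 0) (𝓝 1))
    (hball : (fun r : ℝ => μ.real (HittingStats.rball z r)) =O[𝓝[>] 0] fun r : ℝ => r ^ d)
    (N : ℝ → ℕ) (hN : ∀ r : ℝ, 0 < r → 1 ≤ N r ∧ (N r : ℝ) ^ (-κ') ≤ r ^ v) :
    (z ∉ Function.periodicPts T →
      (∀ α : ℝ, 0 < α → ∀ s : ℝ, 0 < s → HittingStats.HasRecurrenceLimit μ T z α s 1) ∧
      HittingStats.HasRecurrenceLimitZero μ T z 1) ∧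
    (∀ p : ℕ, 0 < p → Function.minimalPeriod T z = p →
      HittingStats.NestedReturns μ T p N
        (fun r => HittingStats.innerApprox T A z (N r) r) →
      ∀ θ : ℝ,
        Tendsto (fun r : ℝ =>
          μ.real (HittingStats.rball z r ∩ T^[p] ⁻¹' HittingStats.rball z r) /
            μ.real (HittingStats.rball z r)) (𝓝[>] 0) (𝓝 θ) →
        (∀ α : ℝ, 0 < α → ∀ s : ℝ, 0 < s →
          HittingStats.HasRecurrenceLimit μ T z α s (1 - θ)) ∧
        HittingStats.HasRecurrenceLimitZero μ T z (1 - θ)) := by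
  have h : HittingStats.BallMixing μ T A φ κ' (max c₁ 0) v d z :=
    { preserving := hμ
      partition := hA
      mixing := hmix
      c_nonneg := le_max_right c₁ 0
      one_lt_v := hv
      d_pos := hd
      v_lt := (one_lt_div (zero_lt_one.trans hv)).1 hκ
      diam := fun n hn C hC => (hdiam n hn C hC).trans
        (ENNReal.ofReal_le_ofReal (by gcongr; exact le_max_left c₁ 0))
      annulus := hannulus
      ball := hball }
  have limits_of_extremalIndex {L : ℝ}
      (hL : HittingStats.HasExtremalIndex μ T (𝓝[>] 0) (HittingStats.rball z) L) :
      (∀ α : ℝ, 0 < α → ∀ s : ℝ, 0 < s → HittingStats.HasRecurrenceLimit μ T z α s L) ∧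
        HittingStats.HasRecurrenceLimitZero μ T z L :=
    ⟨fun _ hα _ hs => h.hasRecurrenceLimit hL hα hs, h.hasRecurrenceLimitZero hL⟩
  refine ⟨fun hz => limits_of_extremalIndex ?_, fun p hp hpz h_nested θ hθ =>
    limits_of_extremalIndex ?_⟩
  · exact HittingStats.hasExtremalIndex_rball_of_notMem_periodicPts
      h.eventually_measureReal_rball_pos hT hz
  · exact HittingStats.hasExtremalIndex_rball_of_nestedReturns
      h.eventually_measureReal_rball_pos hμ hT hp hpz
      (fun r => h.measurableSet_of_cylinderAlgebra (HittingStats.measurableSet_innerApprox _ _))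
      (fun r => HittingStats.innerApprox_subset _ _) (h.tendsto_innerApprox_div hN) h_nested hθ

theorem mainTheorem3 {k : ℕ} {Ω : Type*} [EMetricSpace Ω]
    [ChartedSpace (EuclideanSpace ℝ (Fin k)) Ω] [IsManifold (𝓡 k) ∞ Ω]
    [Bundle.RiemannianBundle (fun x : Ω => TangentSpace (𝓡 k) x)]
    [IsContMDiffRiemannianBundle (𝓡 k) ∞ (EuclideanSpace ℝ (Fin k))
      (fun x : Ω => TangentSpace (𝓡 k) x)]
    [IsRiemannianManifold (𝓡 k) Ω]
    [MeasurableSpace Ω] [BorelSpace Ω]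
    -- the map and the invariant measure
    (T : Ω → Ω) (ζ : ℝ) (hζ₀ : 0 < ζ) (hζ₁ : ζ ≤ 1) (hT : HittingStats.IsC1Holder k ζ T)
    (μ : Measure Ω) [IsProbabilityMeasure μ] (hμ : MeasurePreserving T μ μ)
    -- right `φ`-mixing at polynomial rate `m`
    (A : ℕ → Set Ω) (hA : HittingStats.IsMeasurablePartition A)
    (φ : ℕ → ℝ) (hmix : HittingStats.IsRightPhiMixing μ T A φ)
    (m : ℝ) (hm : 0 < m) (hφ : φ =O[atTop] fun j : ℕ => (j : ℝ) ^ (-m))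
    -- diameters of cylinders, annulus condition, measure of balls
    (κ' c₁ v d : ℝ) (hv : 1 < v) (hd : 0 < d) (hκ : 1 < κ' * d / v)
    (hdiam : ∀ n : ℕ, 1 ≤ n → ∀ C ∈ HittingStats.cylinders T A n,
      Metric.ediam C ≤ ENNReal.ofReal (c₁ * (n : ℝ) ^ (-κ')))
    (hannulus : ∀ z : Ω, Tendsto
      (fun r : ℝ => μ.real (HittingStats.rball z (r + r ^ v)) / μ.real (HittingStats.rball z r))
      (𝓝[>] 0) (𝓝 1))
    (hball : ∀ z : Ω,
      (fun r : ℝ => μ.real (HittingStats.rball z r)) =O[𝓝[>] 0] fun r : ℝ => r ^ d)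
    -- the order of the cylinders that approximate the ball of radius `r`
    (N : ℝ → ℕ) (hN : ∀ r : ℝ, 0 < r → 1 ≤ N r ∧ (N r : ℝ) ^ (-κ') ≤ r ^ v)
    (z : Ω) :
    (z ∉ Function.periodicPts T →
      (∀ α : ℝ, 0 < α →
        (∃ ε β : ℝ, 0 < ε ∧ ε < min 1 α ∧ 0 < β ∧ β < 1 ∧ (1 - ε) / (β * ε) < m) →
        ∀ s : ℝ, 0 < s → HittingStats.HasRecurrenceLimit μ T z α s 1) ∧
      HittingStats.HasRecurrenceLimitZero μ T z 1) ∧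
    (∀ p : ℕ, 0 < p → Function.minimalPeriod T z = p →
      HittingStats.NestedReturns μ T p N
        (fun r => HittingStats.innerApprox T A z (N r) r) →
      HittingStats.NestedReturns μ T p N
        (fun r => HittingStats.outerApprox T A z (N r) r) →
      ∀ θ : ℝ, θ < 1 / 2 →
        Tendsto (fun r : ℝ =>
          μ.real (HittingStats.rball z r ∩ T^[p] ⁻¹' HittingStats.rball z r) /
            μ.real (HittingStats.rball z r)) (𝓝[>] 0) (𝓝 θ) →
        (∀ α : ℝ, 0 < α →
          (∃ ε β : ℝ, 0 < ε ∧ ε < min 1 α ∧ 0 < β ∧ β < 1 ∧ (1 - ε) / (β * ε) < m) →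
          ∀ s : ℝ, 0 < s → HittingStats.HasRecurrenceLimit μ T z α s (1 - θ)) ∧
        HittingStats.HasRecurrenceLimitZero μ T z (1 - θ)) := by
  have h_general := mainTheorem3_general T hT.1.continuous μ hμ A hA φ hmix κ' c₁ v d hv hd hκ
    hdiam z (hannulus z) (hball z) N hN
  exact ⟨fun hz => (h_general.1 hz).imp_left fun h α hα _ => h α hα,
    fun p hp hpz h_inner _ θ _ hθ =>
      (h_general.2 p hp hpz h_inner θ hθ).imp_left fun h α hα _ => h α hα⟩
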